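/- **Theorem 1 (Law of large numbers).** Let $W$ be a white noise on $[-1,1]^2$ with Lebesgue control measure $\lambda_2$, i.e. a centred Gaussian process indexed by the Borel subsets of $[-1,1]^2$ with $\mathbf E[W(A)W(B)]=\lambda_2(A\cap B)$, defined on a probability space $(\Omega_W,\mathcal F_W,\mathbf P_W)$. Let $(\sigma_z)_{z\in[-1,1]^2}$ be a random field with continuous, strictly positive paths, defined on a probability space $(\Omega_\sigma,\mathcal F_\sigma,\mathbf P_\sigma)$, and let $\mathbf P$ be the completion of $\mathbf P_W\otimes\mathbf P_\sigma$, so that $W$ and $\sigma$ are independent. Let $g\in L^2(\mathbb R^2)$ be real-valued, not almost everywhere zero, with essential support contained in $[0,1]^2$, and let $$Y_{(s,t)}=\int g(s-u,t-v)\,\sigma_{(u,v)}\,W(\mathrm du,\mathrm dv),\qquad (s,t)\in[0,1]^2,$$ be the ambit field, where the integral is, conditionally on $\sigma$, the Wiener integral over $[-1,1]^2$ with respect to $W$. For $p>0$ and $k,n\in\mathbb N=\{1,2,\dots\}$ let $$V^{(p)}_{(s,t)}(k,n)=\sum_{i=1}^{\lfloor ns/k\rfloor}\sum_{j=1}^{\lfloor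 nt/k\rfloor}\bigl|Y\bigl(R^{(n)}_{(ki,kj)}\bigr)\bigr|^p,\qquad R^{(n)}_{(i,j)}=\Bigl(\tfrac{i-1}n,\tfrac in\Bigr]\times\Bigl(\tfrac{j-1}n,\tfrac jn\Bigr],$$ where $Y((s_1,s_2]\times(t_1,t_2])=Y_{(s_2,t_2)}-Y_{(s_1,t_2)}-Y_{(s_2,t_1)}+Y_{(s_1,t_1)}$. Put $$h_n(s,t)=g(s,t)-g(s-\tfrac1n,t)-g(s,t-\tfrac1n)+g(s-\tfrac1n,t-\tfrac1n),\quad c_n=\int_{\mathbb R^2}h_n(z)^2\,\mathrm dz,\quad \pi_n(\mathrm dz)=\frac{h_n(z)^2}{c_n}\,\mathrm dz .$$ Let $(k_n)_{n\in\mathbb N}$ be a non-decreasing sequence in $\mathbb N$ with $\varepsilon_n:=k_n/n\to0$ (for instance $k_n=1$ for all $n$), and let $m_p=\mathbf E|X|^p$ for $X\sim N(0,1)$. Assume that there is a Borel probability measure $\pi$ on $\mathbb R^2$ with $\lambda_2(\operatorname{supp}\pi)=0$ such that $\pi_n\to\pi$ weakly. Then, for every $p>0$, $$\frac{\varepsilon_n^2}{c_n^{p/2}}V^{(p)}(k_n,n)\xrightarrow[n\to\infty]{\mathbf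 P}m_p\,\Sigma^{(p,\pi)}\quad\text{in }D([0,1]^2),\qquad \Sigma^{(p,\pi)}_{(s,t)}=\int_0^s\!\int_0^t\Bigl(\int\sigma^2_{(u-\xi,v-\tau)}\,\pi(\mathrm d\xi,\mathrm d\tau)\Bigr)^{p/2}\mathrm du\,\mathrm dv .$$ Here $D([0,1]^2)$ is the space of functions on $[0,1]^2$ that at every point are continuous from the open upper-right quadrant and have limits from the other three open quadrants, with the uniform topology: all the random fields involved have their paths in $D([0,1]^2)$, and the supremum over $[0,1]^2$ of the absolute difference of the two sides tends to $0$ in probability. -/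

import Mathlib

open MeasureTheory ProbabilityTheory Filter Topology
open scoped ENNReal BoundedContinuousFunction

noncomputable section

namespace Ambit

/-- The square `[-1,1]²`. -/
def bigSquare : Set (ℝ × ℝ) := Set.Icc (-1, -1) (1, 1)

/-- The square `[0,1]²`. -/
def unitSquare : Set (ℝ × ℝ) := Set.Icc (0, 0) (1, 1)

theorem measurableSet_bigSquare : MeasurableSet bigSquare := measurableSet_Icc

/-- The Borel subsets of `[-1,1]²`. -/
abbrev BorelSubset : Type := {A : Set (ℝ × ℝ) // MeasurableSet A ∧ A ⊆ bigSquare}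

/-- White noise on `[-1,1]²` with Lebesgue measure as control measure. -/
structure IsWhiteNoise {Ω : Type*} [MeasurableSpace Ω] (P : Measure Ω)
    (W : BorelSubset → Ω → ℝ) : Prop where
  gaussian : IsGaussianProcess W P
  mean_zero : ∀ A, ∫ ω, W A ω ∂P = 0
  covariance : ∀ A B : BorelSubset,
    ∫ ω, W A ω * W B ω ∂P = (volume (A.1 ∩ B.1 : Set (ℝ × ℝ))).toReal

/-- The trace on `[-1,1]²` of the level set `{φ = y}` of a simple function. -/
def levelSet (φ : SimpleFunc (ℝ × ℝ) ℝ) (y : ℝ) : BorelSubset :=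
  ⟨φ ⁻¹' {y} ∩ bigSquare, (φ.measurableSet_fiber y).inter measurableSet_bigSquare,
    Set.inter_subset_right⟩

/-- The elementary integral `∑ y, y W({φ = y})` of a simple function over `[-1,1]²`. -/
def simpleIntegral {Ω : Type*} (W : BorelSubset → Ω → ℝ) (φ : SimpleFunc (ℝ × ℝ) ℝ)
    (ω : Ω) : ℝ :=
  ∑ y ∈ φ.range, y * W (levelSet φ y) ω

/-- `X` is (a version of) the Wiener integral over `[-1,1]²` of `f ∈ L²([-1,1]²)` with respect
to `W`: the `L²(P)`-limit of the elementary integrals of simple functions that tend to `f` in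
`L²([-1,1]²)`. -/
structure IsWienerIntegral {Ω : Type*} [MeasurableSpace Ω] (P : Measure Ω)
    (W : BorelSubset → Ω → ℝ) (f : ℝ × ℝ → ℝ) (X : Ω → ℝ) : Prop where
  memLp_integrand : MemLp f 2 (volume.restrict bigSquare)
  memLp_integral : MemLp X 2 P
  exists_approx : ∃ φ : ℕ → SimpleFunc (ℝ × ℝ) ℝ,
    Tendsto (fun m => eLpNorm (fun z => φ m z - f z) 2 (volume.restrict bigSquare)) atTop (𝓝 0) ∧
    Tendsto (fun m => eLpNorm (fun ω => simpleIntegral W (φ m) ω - X ω) 2 P) atTop (𝓝 0)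

/-- A continuous, strictly positive random field `(σ_z)`, `z ∈ [-1,1]²`. Values of `σ ω` outside
`[-1,1]²` are never used. -/
structure IsVolatilityField {Ω : Type*} [MeasurableSpace Ω] (σ : Ω → ℝ × ℝ → ℝ) : Prop where
  measurable : ∀ z ∈ bigSquare, Measurable fun ω => σ ω z
  continuousOn : ∀ ω, ContinuousOn (σ ω) bigSquare
  pos : ∀ ω, ∀ z ∈ bigSquare, 0 < σ ω z

/-- The essential support of `g`: the complement of the union of all open sets on which `g`
vanishes almost everywhere. -/
def essSupport (g : ℝ × ℝ → ℝ) : Set (ℝ × ℝ) :=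
  (⋃₀ {U : Set (ℝ × ℝ) | IsOpen U ∧ ∀ᵐ z ∂(volume.restrict U), g z = 0})ᶜ

/-- A weight function: a function in `L²(ℝ²)` that is not almost everywhere zero and whose
essential support lies in `[0,1]²`. -/
structure IsWeightFunction (g : ℝ × ℝ → ℝ) : Prop where
  memLp : MemLp g 2 volume
  nonvanishing : ¬ g =ᵐ[volume] 0
  essSupport_subset : essSupport g ⊆ unitSquare

/-- `Y` is the ambit field `Y_z = ∫ g(z - w) σ_w W(dw)`, `z ∈ [0,1]²`, on the product of the
space of `W` and the space of `σ`: the integral is the Wiener integral conditional on `σ`.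
Measurability is with respect to the completed product `σ`-algebra. -/
structure IsAmbitField {ΩW Ωσ : Type*} [MeasurableSpace ΩW] [MeasurableSpace Ωσ]
    (PW : Measure ΩW) (Pσ : Measure Ωσ) (W : BorelSubset → ΩW → ℝ) (σ : Ωσ → ℝ × ℝ → ℝ)
    (g : ℝ × ℝ → ℝ) (Y : ℝ × ℝ → ΩW × Ωσ → ℝ) : Prop where
  aemeasurable : ∀ z ∈ unitSquare, AEMeasurable (Y z) (PW.prod Pσ)
  isWienerIntegral : ∀ z ∈ unitSquare, ∀ᵐ ω' ∂Pσ,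
    IsWienerIntegral PW W (fun w => g (z - w) * σ ω' w) (fun ω => Y z (ω, ω'))

/-- The increment of `y` over the rectangle `(s₁,s₂] × (t₁,t₂]`. -/
def rectIncrement (y : ℝ × ℝ → ℝ) (s₁ s₂ t₁ t₂ : ℝ) : ℝ :=
  y (s₂, t₂) - y (s₁, t₂) - y (s₂, t₁) + y (s₁, t₁)

/-- The increment of `y` over `((i-1)/n, i/n] × ((j-1)/n, j/n]`. -/
def latticeIncrement (y : ℝ × ℝ → ℝ) (n i j : ℕ) : ℝ :=
  rectIncrement y (((i : ℝ) - 1) / n) ((i : ℝ) / n) (((j : ℝ) - 1) / n) ((j : ℝ) / n)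

/-- The `p`-th power variation of `y` over the lattice of mesh `1/n` with thinning parameter `k`,
at `z = (s,t)`. -/
def powerVariation (y : ℝ × ℝ → ℝ) (p : ℝ) (k n : ℕ) (z : ℝ × ℝ) : ℝ :=
  ∑ i ∈ Finset.Icc 1 ⌊(n : ℝ) * z.1 / k⌋₊, ∑ j ∈ Finset.Icc 1 ⌊(n : ℝ) * z.2 / k⌋₊,
    |latticeIncrement y n (k * i) (k * j)| ^ p

/-- `h_n(s,t) = g(s,t) - g(s-1/n,t) - g(s,t-1/n) + g(s-1/n,t-1/n)`. -/
def incrementKernel (g : ℝ × ℝ → ℝ) (n : ℕ) (z : ℝ × ℝ) : ℝ :=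
  g z - g (z.1 - 1 / n, z.2) - g (z.1, z.2 - 1 / n) + g (z.1 - 1 / n, z.2 - 1 / n)

/-- `c_n = ∫ h_n²`. -/
def scaling (g : ℝ × ℝ → ℝ) (n : ℕ) : ℝ :=
  ∫ z, incrementKernel g n z ^ 2

/-- The concentration measure `π_n(dz) = h_n(z)² / c_n dz`. -/
def concentrationMeasure (g : ℝ × ℝ → ℝ) (n : ℕ) : Measure (ℝ × ℝ) :=
  volume.withDensity fun z => ENNReal.ofReal (incrementKernel g n z ^ 2 / scaling g n)

/-- Weak convergence of a sequence of Borel measures on `ℝ²`. -/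
def ConvergesWeakly (ν : ℕ → Measure (ℝ × ℝ)) (π : Measure (ℝ × ℝ)) : Prop :=
  ∀ f : (ℝ × ℝ) →ᵇ ℝ, Tendsto (fun n => ∫ z, f z ∂(ν n)) atTop (𝓝 (∫ z, f z ∂π))

/-- `m_p = E|X|^p` for a standard Gaussian variable `X`. -/
def gaussianAbsMoment (p : ℝ) : ℝ :=
  ∫ x, |x| ^ p ∂(gaussianReal 0 1)

/-- `∫_0^s ∫_0^t (∫ y(u-ξ,v-τ)² π(dξ,dτ))^{p/2} du dv` at `z = (s,t)`, for a path `y` of the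
volatility field. -/
def integratedVolatility (y : ℝ × ℝ → ℝ) (p : ℝ) (π : Measure (ℝ × ℝ)) (z : ℝ × ℝ) : ℝ :=
  ∫ u in (0 : ℝ)..z.1, ∫ v in (0 : ℝ)..z.2, (∫ w, y (u - w.1, v - w.2) ^ 2 ∂π) ^ (p / 2)

/-- The restriction of `f` to `[0,1]²` belongs to the two-parameter càdlàg space `D([0,1]²)`:
continuity from the first quadrant and limits from the other three open quadrants. -/
def IsCadlag (f : ℝ × ℝ → ℝ) : Prop :=
  ∀ s ∈ Set.Icc (0 : ℝ) 1, ∀ t ∈ Set.Icc (0 : ℝ) 1,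
    Tendsto f (𝓝[Set.Ioc s 1 ×ˢ Set.Ioc t 1] (s, t)) (𝓝 (f (s, t))) ∧
    (∃ l, Tendsto f (𝓝[Set.Ico 0 s ×ˢ Set.Ioc t 1] (s, t)) (𝓝 l)) ∧
    (∃ l, Tendsto f (𝓝[Set.Ico 0 s ×ˢ Set.Ico 0 t] (s, t)) (𝓝 l)) ∧
    (∃ l, Tendsto f (𝓝[Set.Ioc s 1 ×ˢ Set.Ico 0 t] (s, t)) (𝓝 l))

/-- The uniform distance on `[0,1]²`. -/
def uniformDist (f₁ f₂ : ℝ × ℝ → ℝ) : ℝ≥0∞ :=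
  ⨆ z ∈ unitSquare, edist (f₁ z) (f₂ z)

/-- Convergence in probability in `D([0,1]²)` with the uniform topology: from `n = 1` on, all
paths lie in `D([0,1]²)`, and the uniform distance to the limit tends to zero in probability. -/
def TendstoInProbabilityCadlag {Ω : Type*} [MeasurableSpace Ω] (P : Measure Ω)
    (U : ℕ → Ω → ℝ × ℝ → ℝ) (U' : Ω → ℝ × ℝ → ℝ) : Prop :=
  (∀ n, 1 ≤ n → ∀ ω, IsCadlag (U n ω)) ∧ (∀ ω, IsCadlag (U' ω)) ∧
    ∀ ε : ℝ, 0 < ε →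
      Tendsto (fun n => P {ω | ENNReal.ofReal ε ≤ uniformDist (U n ω) (U' ω)}) atTop (𝓝 0)

end Ambit

end

/-! Fix a path of `σ`. An increment of the ambit field over the cell of side `1/n` with upper right
corner `z` is the Wiener integral of `w ↦ h_n(z - w) σ_w`. It is centred Gaussian with variance `c_n
∫ σ²(z - ξ) π_n(dξ)` (`integral_sq_incrementKernel_mul`). The conditional mean of the normalized
variation is therefore `m_p` times a Riemann sum of `(∫ σ²(z - ξ) π_n(dξ))^{p/2}`. Weak convergence
of `π_n` and uniform continuity of `σ²` make it converge to `m_p Σ` (`tendsto_avgVol`,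
`tendsto_riemann_sum`).

The conditional variance is a double sum of covariances of `|Z|^p`, `|Z'|^p` for standardized
increments `Z`, `Z'`. Each is at most `η + C|ρ|`, where `ρ` is their correlation, `η` is as small as
desired and `C` depends on `p` and `η` only (`exists_abs_covariance_abs_rpow_le`). The averaged
correlation tends to zero (`tendsto_correlation_sum`): almost all of the mass of `h_n²` lies near
`supp π`, whose thickenings have small area. A point `w` thus lies in the essential range of few of
the kernels `h_n(z - ·)`, and most pairs of kernels barely overlap. Chebyshev's inequality gives
convergence at each point, conditionally on `σ`.

Dominated convergence over `σ` removes the conditioning (`tendsto_prod_measure_of_ae_tendsto`). Both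
sides are monotone in `(s,t)` and the limit is continuous, so convergence on a finite grid becomes
uniform, as in Pólya's theorem (`uniformDist_lt_of_grid`). -/

namespace Ambit

/-! ### Wiener integrals: isometry, linearity and Gaussian law -/

section WienerIntegral

variable {Ω : Type*} [MeasurableSpace Ω] {P : Measure Ω} {W : BorelSubset → Ω → ℝ}

theorem isCompact_bigSquare : IsCompact bigSquare := isCompact_Icc

instance isFiniteMeasure_restrict_bigSquare :
    IsFiniteMeasure ((volume : Measure (ℝ × ℝ)).restrict bigSquare) :=
  ⟨by simpa using isCompact_bigSquare.measure_lt_top⟩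

theorem memLp_simpleFunc (φ : SimpleFunc (ℝ × ℝ) ℝ) :
    MemLp φ 2 (volume.restrict bigSquare) :=
  SimpleFunc.memLp_of_isFiniteMeasure φ 2 _

theorem IsWhiteNoise.hasGaussianLaw_simpleIntegral (hW : IsWhiteNoise P W)
    (φ : SimpleFunc (ℝ × ℝ) ℝ) : HasGaussianLaw (simpleIntegral W φ) P := by
  have h := (hW.gaussian.comp_right (levelSet φ)).smul (fun y => y)
  exact h.hasGaussianLaw_fun_sum (I := φ.range)

theorem IsWhiteNoise.memLp (hW : IsWhiteNoise P W) (A : BorelSubset) : MemLp (W A) 2 P :=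
  (hW.gaussian.hasGaussianLaw_eval A).memLp_two

theorem IsWhiteNoise.memLp_simpleIntegral (hW : IsWhiteNoise P W)
    (φ : SimpleFunc (ℝ × ℝ) ℝ) : MemLp (simpleIntegral W φ) 2 P :=
  (hW.hasGaussianLaw_simpleIntegral φ).memLp_two

theorem IsWhiteNoise.integral_simpleIntegral (hW : IsWhiteNoise P W)
    (φ : SimpleFunc (ℝ × ℝ) ℝ) : ∫ ω, simpleIntegral W φ ω ∂P = 0 := by
  have := hW.gaussian.isProbabilityMeasure
  simp only [simpleIntegral]
  rw [integral_finsetSum _ fun y _ => ((hW.memLp _).integrable one_le_two).const_mul y]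
  simp [integral_const_mul, hW.mean_zero]

theorem simpleFunc_eq_sum_indicator (φ : SimpleFunc (ℝ × ℝ) ℝ) (z : ℝ × ℝ) :
    φ z = ∑ y ∈ φ.range, y * (φ ⁻¹' {y}).indicator (fun _ => (1 : ℝ)) z := by
  rw [Finset.sum_eq_single (φ z)]
  · simp
  · intro y _ hy
    simp [Set.indicator, hy.symm]
  · intro h
    simp at h

/-- The Itô isometry for elementary integrals. -/
theorem IsWhiteNoise.integral_simpleIntegral_mul (hW : IsWhiteNoise P W)
    (φ ψ : SimpleFunc (ℝ × ℝ) ℝ) :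
    ∫ ω, simpleIntegral W φ ω * simpleIntegral W ψ ω ∂P =
      ∫ z in bigSquare, φ z * ψ z := by
  have hL : ∀ ω, simpleIntegral W φ ω * simpleIntegral W ψ ω =
      ∑ y ∈ φ.range, ∑ x ∈ ψ.range, y * x * (W (levelSet φ y) ω * W (levelSet ψ x) ω) := by
    intro ω
    simp only [simpleIntegral, Finset.sum_mul_sum]
    exact Finset.sum_congr rfl fun y _ => Finset.sum_congr rfl fun x _ => by ring
  have hR : ∀ z, φ z * ψ z = ∑ y ∈ φ.range, ∑ x ∈ ψ.range,
      y * x * (φ ⁻¹' {y} ∩ ψ ⁻¹' {x}).indicator (fun _ => (1 : ℝ)) z := by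
    intro z
    rw [simpleFunc_eq_sum_indicator φ z, simpleFunc_eq_sum_indicator ψ z, Finset.sum_mul_sum]
    refine Finset.sum_congr rfl fun y _ => Finset.sum_congr rfl fun x _ => ?_
    rw [← Set.indicator_indicator]
    by_cases h1 : z ∈ φ ⁻¹' {y} <;> by_cases h2 : z ∈ ψ ⁻¹' {x} <;> simp [Set.indicator, h1, h2]
  have hInt : ∀ A B, Integrable (fun ω => W A ω * W B ω) P := fun A B =>
    (hW.memLp A).integrable_mul (hW.memLp B)
  have hms : ∀ y x, MeasurableSet (φ ⁻¹' {y} ∩ ψ ⁻¹' {x}) := fun y x =>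
    (φ.measurableSet_fiber y).inter (ψ.measurableSet_fiber x)
  have hind : ∀ y x, Integrable ((φ ⁻¹' {y} ∩ ψ ⁻¹' {x}).indicator (fun _ => (1 : ℝ)))
      (volume.restrict bigSquare) := fun y x => (integrable_const 1).indicator (hms y x)
  simp_rw [hL, hR]
  rw [integral_finsetSum _ fun y _ => integrable_finsetSum _ fun x _ => (hInt _ _).const_mul _,
    integral_finsetSum _ fun y _ => integrable_finsetSum _ fun x _ => (hind _ _).const_mul _]
  refine Finset.sum_congr rfl fun y _ => ?_
  rw [integral_finsetSum _ fun x _ => (hInt _ _).const_mul _,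
    integral_finsetSum _ fun x _ => (hind _ _).const_mul _]
  refine Finset.sum_congr rfl fun x _ => ?_
  rw [integral_const_mul, integral_const_mul, hW.covariance, integral_indicator (hms y x),
    setIntegral_const, measureReal_restrict_apply (hms y x)]
  congr 1
  simp only [levelSet, smul_eq_mul, mul_one, Measure.real]
  congr 2
  ext z
  simp only [Set.mem_inter_iff]
  tauto

/-- The level sets of a combination are not those of its summands, so linearity is not termwise
algebra and holds almost surely only. By the isometry the difference has second moment zero. -/
theorem IsWhiteNoise.simpleIntegral_linearComb (hW : IsWhiteNoise P W) (a b : ℝ)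
    (φ ψ : SimpleFunc (ℝ × ℝ) ℝ) :
    simpleIntegral W (a • φ + b • ψ) =ᵐ[P]
      fun ω => a * simpleIntegral W φ ω + b * simpleIntegral W ψ ω := by
  set χ := a • φ + b • ψ
  set I := simpleIntegral W
  have hI : ∀ φ ψ, Integrable (fun ω => I φ ω * I ψ ω) P := fun φ ψ =>
    (hW.memLp_simpleIntegral φ).integrable_mul (hW.memLp_simpleIntegral ψ)
  have hJ : ∀ φ ψ : SimpleFunc (ℝ × ℝ) ℝ,
      Integrable (fun z => φ z * ψ z) (volume.restrict bigSquare) := fun φ ψ =>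
    (memLp_simpleFunc φ).integrable_mul (memLp_simpleFunc ψ)
  have key : ∫ ω, (I χ ω - (a * I φ ω + b * I ψ ω)) ^ 2 ∂P = 0 := by
    have e1 : ∀ u v w : ℝ, (u - (a * v + b * w)) ^ 2 =
        u * u + (-2 * a) * (u * v) + (-2 * b) * (u * w) + a ^ 2 * (v * v) +
          2 * a * b * (v * w) + b ^ 2 * (w * w) := by intros; ring
    have e2 : ∫ z in bigSquare, (χ z - (a * φ z + b * ψ z)) ^ 2 = 0 := by
      have : ∀ z, (χ z - (a * φ z + b * ψ z)) ^ 2 = 0 := by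
        intro z; simp [χ]
      simp [this]
    rw [← e2]
    simp_rw [e1]
    -- Both squares split into six products, which the isometry matches one by one.
    rw [integral_add, integral_add, integral_add, integral_add, integral_add,
      integral_add, integral_add, integral_add, integral_add, integral_add]
    · simp only [integral_const_mul, I, hW.integral_simpleIntegral_mul]
    all_goals
      repeat'
        first
        | exact (hI _ _).const_mul _
        | exact (hJ _ _).const_mul _
        | exact hI _ _
        | exact hJ _ _
        | refine Integrable.add ?_ ?_
  have hmem : MemLp (fun ω => I χ ω - (a * I φ ω + b * I ψ ω)) 2 P :=
    (hW.memLp_simpleIntegral χ).sub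
      (((hW.memLp_simpleIntegral φ).const_mul a).add ((hW.memLp_simpleIntegral ψ).const_mul b))
  rw [integral_eq_zero_iff_of_nonneg (fun ω => sq_nonneg _) hmem.integrable_sq] at key
  filter_upwards [key] with ω hω
  have : I χ ω - (a * I φ ω + b * I ψ ω) = 0 := by simpa using hω
  linarith

theorem IsWienerIntegral.linearComb (hW : IsWhiteNoise P W) {f f' : ℝ × ℝ → ℝ} {X X' : Ω → ℝ}
    (h : IsWienerIntegral P W f X) (h' : IsWienerIntegral P W f' X') (a b : ℝ) :
    IsWienerIntegral P W (fun z => a * f z + b * f' z) (fun ω => a * X ω + b * X' ω) := by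
  obtain ⟨φ, hφ, hφX⟩ := h.exists_approx
  obtain ⟨ψ, hψ, hψX⟩ := h'.exists_approx
  have lim : ∀ {u v : ℕ → ℝ≥0∞}, Tendsto u atTop (𝓝 0) → Tendsto v atTop (𝓝 0) →
      Tendsto (fun m => ‖a‖ₑ * u m + ‖b‖ₑ * v m) atTop (𝓝 0) := by
    intro u v hu hv
    have := (ENNReal.Tendsto.const_mul (a := ‖a‖ₑ) hu (.inr (by simp))).add
      (ENNReal.Tendsto.const_mul (a := ‖b‖ₑ) hv (.inr (by simp)))
    simpa using this
  refine ⟨(h.memLp_integrand.const_mul a).add (h'.memLp_integrand.const_mul b),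
    (h.memLp_integral.const_mul a).add (h'.memLp_integral.const_mul b),
    fun m => a • φ m + b • ψ m, ?_, ?_⟩
  · refine tendsto_of_tendsto_of_tendsto_of_le_of_le tendsto_const_nhds (lim hφ hψ)
      (fun _ => zero_le) fun m => ?_
    have h1 := (memLp_simpleFunc (φ m)).sub h.memLp_integrand
    have h2 := (memLp_simpleFunc (ψ m)).sub h'.memLp_integrand
    have e : (fun z => (a • φ m + b • ψ m) z - (a * f z + b * f' z)) =
        a • (fun z => φ m z - f z) + b • (fun z => ψ m z - f' z) := by
      ext z; simp; ring
    rw [e]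
    refine (eLpNorm_add_le (h1.const_smul a).1 (h2.const_smul b).1 one_le_two).trans ?_
    rw [eLpNorm_const_smul, eLpNorm_const_smul]
    exact le_rfl
  · refine tendsto_of_tendsto_of_tendsto_of_le_of_le tendsto_const_nhds (lim hφX hψX)
      (fun _ => zero_le) fun m => ?_
    have h1 := (hW.memLp_simpleIntegral (φ m)).sub h.memLp_integral
    have h2 := (hW.memLp_simpleIntegral (ψ m)).sub h'.memLp_integral
    have e : (fun ω => simpleIntegral W (a • φ m + b • ψ m) ω - (a * X ω + b * X' ω)) =ᵐ[P]
        a • (fun ω => simpleIntegral W (φ m) ω - X ω) +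
          b • (fun ω => simpleIntegral W (ψ m) ω - X' ω) := by
      filter_upwards [hW.simpleIntegral_linearComb a b (φ m) (ψ m)] with ω hω
      rw [hω]; simp; ring
    rw [eLpNorm_congr_ae e]
    refine (eLpNorm_add_le (h1.const_smul a).1 (h2.const_smul b).1 one_le_two).trans ?_
    rw [eLpNorm_const_smul, eLpNorm_const_smul]
    exact le_rfl

theorem tendsto_integral_sq_of_tendsto_eLpNorm {α : Type*} [MeasurableSpace α] {μ : Measure α}
    {F : ℕ → α → ℝ} {f : α → ℝ} (hF : ∀ m, MemLp (F m) 2 μ) (hf : MemLp f 2 μ)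
    (h : Tendsto (fun m => eLpNorm (fun z => F m z - f z) 2 μ) atTop (𝓝 0)) :
    Tendsto (fun m => ∫ z, F m z ^ 2 ∂μ) atTop (𝓝 (∫ z, f z ^ 2 ∂μ)) := by
  have key : ∀ {g : α → ℝ} (hg : MemLp g 2 μ), ∫ z, g z ^ 2 ∂μ = ‖hg.toLp g‖ ^ 2 := by
    intro g hg
    rw [← real_inner_self_eq_norm_sq, L2.inner_def]
    refine integral_congr_ae ?_
    filter_upwards [hg.coeFn_toLp] with z hz
    simp [hz, sq]
  simp_rw [key (hF _), key hf]
  refine ((continuous_norm.tendsto _).comp ?_).pow 2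
  exact (Lp.tendsto_Lp_iff_tendsto_eLpNorm'' F hF f hf).2 h

theorem IsWhiteNoise.hasLaw_simpleIntegral (hW : IsWhiteNoise P W) (φ : SimpleFunc (ℝ × ℝ) ℝ) :
    HasLaw (simpleIntegral W φ) (gaussianReal 0 (∫ z in bigSquare, φ z ^ 2).toNNReal) P := by
  have := hW.gaussian.isProbabilityMeasure
  have hG := hW.hasGaussianLaw_simpleIntegral φ
  refine ⟨hG.aemeasurable, ?_⟩
  rw [hG.map_eq_gaussianReal, hW.integral_simpleIntegral,
    variance_of_integral_eq_zero hG.aemeasurable (hW.integral_simpleIntegral φ)]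
  simp_rw [sq, ← hW.integral_simpleIntegral_mul]

/-- The Wiener integral of `f` is centred Gaussian with variance `∫ f²`. -/
theorem IsWienerIntegral.hasLaw (hW : IsWhiteNoise P W) {f : ℝ × ℝ → ℝ} {X : Ω → ℝ}
    (h : IsWienerIntegral P W f X) :
    HasLaw X (gaussianReal 0 (∫ z in bigSquare, f z ^ 2).toNNReal) P := by
  have := hW.gaussian.isProbabilityMeasure
  obtain ⟨φ, hφ, hφX⟩ := h.exists_approx
  have hXm := h.memLp_integral.1
  refine ⟨hXm.aemeasurable, ?_⟩
  have hmeas : TendstoInMeasure P (fun m => simpleIntegral W (φ m)) atTop X :=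
    tendstoInMeasure_of_tendsto_eLpNorm (by simp) (fun m => (hW.memLp_simpleIntegral (φ m)).1)
      hXm hφX
  obtain ⟨ns, hns, hlim⟩ := hmeas.exists_seq_tendsto_ae
  have hvar := (tendsto_integral_sq_of_tendsto_eLpNorm (fun m => memLp_simpleFunc (φ m))
    h.memLp_integrand hφ).comp hns.tendsto_atTop
  have : IsProbabilityMeasure (P.map X) := Measure.isProbabilityMeasure_map hXm.aemeasurable
  -- Along the almost surely convergent subsequence the characteristic functions have two limits:
  -- that of `X`, by dominated convergence, and the Gaussian one, by convergence of the variances.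
  refine Measure.ext_of_charFun (funext fun t => ?_)
  have h1 : Tendsto (fun m => charFun (P.map (simpleIntegral W (φ (ns m)))) t) atTop
      (𝓝 (charFun (P.map X) t)) := by
    simp_rw [charFun_apply_real]
    rw [integral_map hXm.aemeasurable (by fun_prop)]
    have : ∀ m, ∫ x, Complex.exp (t * x * Complex.I) ∂(P.map (simpleIntegral W (φ (ns m)))) =
        ∫ ω, Complex.exp (t * (simpleIntegral W (φ (ns m)) ω) * Complex.I) ∂P := fun m =>
      integral_map (hW.memLp_simpleIntegral _).1.aemeasurable (by fun_prop)
    simp_rw [this]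
    refine tendsto_integral_of_dominated_convergence (fun _ => 1) (fun m => ?_)
      (integrable_const 1) (fun m => ?_) ?_
    · have := (hW.memLp_simpleIntegral (φ (ns m))).1.aemeasurable
      exact AEMeasurable.aestronglyMeasurable (by fun_prop)
    · refine ae_of_all _ fun ω => ?_
      rw [← Complex.ofReal_mul, Complex.norm_exp_ofReal_mul_I]
    · filter_upwards [hlim] with ω hω
      have hc : Continuous fun x : ℝ => Complex.exp (t * x * Complex.I) := by fun_prop
      exact (hc.tendsto _).comp hω
  have h2 : Tendsto (fun m => charFun (P.map (simpleIntegral W (φ (ns m)))) t) atTop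
      (𝓝 (charFun (gaussianReal 0 (∫ z in bigSquare, f z ^ 2).toNNReal) t)) := by
    simp_rw [(hW.hasLaw_simpleIntegral _).map_eq, charFun_gaussianReal]
    have hc : Continuous fun v : ℝ =>
        Complex.exp (t * (0 : ℝ) * Complex.I - (v.toNNReal : ℝ) * t ^ 2 / 2) := by
      have : Continuous fun v : ℝ => ((v.toNNReal : ℝ) : ℂ) :=
        Complex.continuous_ofReal.comp (NNReal.continuous_coe.comp continuous_real_toNNReal)
      fun_prop
    exact (hc.tendsto _).comp hvar
  exact tendsto_nhds_unique h1 h2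

end WienerIntegral

/-! ### Absolute moments of correlated Gaussian pairs -/

section GaussianMoments

theorem integrable_abs_rpow_gaussianReal {p : ℝ} (hp : 0 < p) :
    Integrable (fun x : ℝ => |x| ^ p) (gaussianReal 0 1) := by
  have h := (memLp_id_gaussianReal' (μ := 0) (v := 1) (ENNReal.ofReal p)
    (by simp)).integrable_norm_rpow (by simpa using hp) (by simp)
  simpa [ENNReal.toReal_ofReal hp.le] using h

theorem gaussianAbsMoment_nonneg (p : ℝ) : 0 ≤ gaussianAbsMoment p :=
  integral_nonneg fun _ => by positivity

/-- The moment `E |X|^p |X'|^p` of standard Gaussian variables `X`, `X'` with correlation `ρ`. -/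
noncomputable def jointAbsMoment (p ρ : ℝ) : ℝ :=
  ∫ q : ℝ × ℝ, |q.1| ^ p * |ρ * q.1 + √(1 - ρ ^ 2) * q.2| ^ p
    ∂((gaussianReal 0 1).prod (gaussianReal 0 1))

theorem jointAbsMoment_zero (p : ℝ) : jointAbsMoment p 0 = gaussianAbsMoment p ^ 2 := by
  simp only [jointAbsMoment, gaussianAbsMoment]
  rw [sq (∫ x, |x| ^ p ∂_), ← integral_prod_mul]
  simp

/-- The right side is free of `ρ` and Gaussian-integrable, hence a dominating function for limits in
`ρ`. Passing through the maximum avoids convexity, which fails for `p < 1`. -/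
theorem abs_mul_abs_rpow_le {p ρ : ℝ} (hp : 0 < p) (hρ : |ρ| ≤ 1) (x z : ℝ) :
    |x| ^ p * |ρ * x + √(1 - ρ ^ 2) * z| ^ p ≤
      2 ^ p * (|x| ^ p * |x| ^ p + |x| ^ p * |z| ^ p) := by
  have h1 : |ρ * x + √(1 - ρ ^ 2) * z| ≤ |x| + |z| := by
    refine (abs_add_le _ _).trans ?_
    rw [abs_mul, abs_mul]
    have : |√(1 - ρ ^ 2)| ≤ 1 := by
      rw [abs_of_nonneg (Real.sqrt_nonneg _)]
      exact Real.sqrt_le_one.2 (by nlinarith [sq_nonneg ρ])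
    gcongr
    · exact mul_le_of_le_one_left (abs_nonneg x) hρ
    · exact mul_le_of_le_one_left (abs_nonneg z) this
  have h2 : (|x| + |z|) ^ p ≤ 2 ^ p * (|x| ^ p + |z| ^ p) := by
    calc (|x| + |z|) ^ p ≤ (2 * max |x| |z|) ^ p := by
          refine Real.rpow_le_rpow (by positivity) ?_ hp.le
          linarith [le_max_left |x| |z|, le_max_right |x| |z|]
      _ = 2 ^ p * (max |x| |z|) ^ p := Real.mul_rpow (by norm_num) (by positivity)
      _ ≤ _ := by
          gcongr
          rcases max_cases |x| |z| with h | h <;> rw [h.1]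
          · linarith [Real.rpow_nonneg (abs_nonneg z) p]
          · linarith [Real.rpow_nonneg (abs_nonneg x) p]
  calc _ ≤ |x| ^ p * (2 ^ p * (|x| ^ p + |z| ^ p)) := by
        gcongr
        exact (Real.rpow_le_rpow (abs_nonneg _) h1 hp.le).trans h2
    _ = _ := by ring

theorem integrable_jointAbsMoment_bound {p : ℝ} (hp : 0 < p) :
    Integrable (fun q : ℝ × ℝ => 2 ^ p * (|q.1| ^ p * |q.1| ^ p + |q.1| ^ p * |q.2| ^ p))
      ((gaussianReal 0 1).prod (gaussianReal 0 1)) := by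
  have h := integrable_abs_rpow_gaussianReal hp
  have h2 : Integrable (fun x : ℝ => |x| ^ p * |x| ^ p) (gaussianReal 0 1) := by
    refine (integrable_abs_rpow_gaussianReal (p := p + p) (by linarith)).congr (ae_of_all _ ?_)
    intro x
    exact Real.rpow_add_of_nonneg (abs_nonneg x) hp.le hp.le
  exact ((h2.comp_fst _).add (h.mul_prod h)).const_mul _

theorem measurable_jointAbsMoment_integrand (p ρ : ℝ) :
    Measurable fun q : ℝ × ℝ => |q.1| ^ p * |ρ * q.1 + √(1 - ρ ^ 2) * q.2| ^ p := by
  fun_prop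

theorem jointAbsMoment_nonneg (p ρ : ℝ) : 0 ≤ jointAbsMoment p ρ :=
  integral_nonneg fun _ => by positivity

theorem exists_jointAbsMoment_le {p : ℝ} (hp : 0 < p) :
    ∃ D, ∀ ρ, |ρ| ≤ 1 → jointAbsMoment p ρ ≤ D := by
  refine ⟨_, fun ρ hρ => integral_mono_of_nonneg (ae_of_all _ fun q => by positivity)
    (integrable_jointAbsMoment_bound hp)
    (ae_of_all _ fun q => abs_mul_abs_rpow_le hp hρ q.1 q.2)⟩

theorem tendsto_jointAbsMoment {p : ℝ} (hp : 0 < p) :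
    Tendsto (jointAbsMoment p) (𝓝 0) (𝓝 (gaussianAbsMoment p ^ 2)) := by
  rw [← jointAbsMoment_zero]
  refine tendsto_integral_filter_of_dominated_convergence _
    (Eventually.of_forall fun ρ => (measurable_jointAbsMoment_integrand p ρ).aestronglyMeasurable)
    ?_ (integrable_jointAbsMoment_bound hp) (ae_of_all _ fun q => ?_)
  · have : ∀ᶠ ρ : ℝ in 𝓝 0, |ρ| ≤ 1 := by
      filter_upwards [Metric.closedBall_mem_nhds (0 : ℝ) one_pos] with ρ hρ
      simpa using hρ
    filter_upwards [this] with ρ hρ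
    refine ae_of_all _ fun q => ?_
    rw [Real.norm_of_nonneg (by positivity)]
    exact abs_mul_abs_rpow_le hp hρ q.1 q.2
  · have h : Continuous fun ρ : ℝ => |q.1| ^ p * |ρ * q.1 + √(1 - ρ ^ 2) * q.2| ^ p := by
      refine continuous_const.mul (Continuous.rpow_const (by fun_prop) fun _ => .inr hp.le)
    exact h.tendsto 0

/-- Absolute powers of weakly correlated Gaussian variables are weakly correlated. -/
theorem exists_abs_jointAbsMoment_sub_le {p : ℝ} (hp : 0 < p) {η : ℝ} (hη : 0 < η) :
    ∃ C, 0 ≤ C ∧ ∀ ρ, |ρ| ≤ 1 →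
      |jointAbsMoment p ρ - gaussianAbsMoment p ^ 2| ≤ η + C * |ρ| := by
  obtain ⟨D, hD⟩ := exists_jointAbsMoment_le hp
  obtain ⟨r, hr, hr'⟩ := Metric.tendsto_nhds_nhds.1 (tendsto_jointAbsMoment hp) η hη
  have hD0 : 0 ≤ D := (jointAbsMoment_nonneg p 0).trans (hD 0 (by simp))
  -- For `|ρ| < r` continuity at zero gives `η`. For `|ρ| ≥ r` the trivial bound `D + m_p²` is at
  -- most `C|ρ|` with this `C`.
  refine ⟨(D + gaussianAbsMoment p ^ 2) / r, by positivity, fun ρ hρ => ?_⟩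
  by_cases h : |ρ| < r
  · have := hr' (x := ρ) (by simpa using h)
    rw [Real.dist_eq] at this
    have h3 : 0 ≤ (D + gaussianAbsMoment p ^ 2) / r * |ρ| := by positivity
    linarith
  · have h1 : |jointAbsMoment p ρ - gaussianAbsMoment p ^ 2| ≤ D + gaussianAbsMoment p ^ 2 := by
      have := jointAbsMoment_nonneg p ρ
      have := hD ρ hρ
      rw [abs_le]
      constructor <;> nlinarith [sq_nonneg (gaussianAbsMoment p)]
    have h2 : D + gaussianAbsMoment p ^ 2 ≤ (D + gaussianAbsMoment p ^ 2) / r * |ρ| := by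
      rw [div_mul_eq_mul_div, le_div_iff₀ hr]
      exact mul_le_mul_of_nonneg_left (not_lt.1 h) (by positivity)
    linarith

variable {Ω : Type*} [MeasurableSpace Ω] {P : Measure Ω} [IsProbabilityMeasure P] {X X' : Ω → ℝ}

/-- Cramér–Wold: the laws of all linear combinations determine the joint law, here that of a
standard Gaussian pair under the linear map `T`. -/
theorem map_prodMk_eq_of_hasLaw {ρ : ℝ} (hρ : |ρ| ≤ 1) (hX : AEMeasurable X P)
    (hX' : AEMeasurable X' P)
    (h : ∀ a b : ℝ, HasLaw (fun ω => a * X ω + b * X' ω)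
      (gaussianReal 0 (a ^ 2 + 2 * a * b * ρ + b ^ 2).toNNReal) P) :
    P.map (fun ω => (X ω, X' ω)) = ((gaussianReal 0 1).prod (gaussianReal 0 1)).map
      (fun q : ℝ × ℝ => (q.1, ρ * q.1 + √(1 - ρ ^ 2) * q.2)) := by
  set T : ℝ × ℝ →L[ℝ] ℝ × ℝ := (ContinuousLinearMap.fst ℝ ℝ ℝ).prod
    (ρ • ContinuousLinearMap.fst ℝ ℝ ℝ + √(1 - ρ ^ 2) • ContinuousLinearMap.snd ℝ ℝ ℝ) with hT
  have hTe : (fun q : ℝ × ℝ => (q.1, ρ * q.1 + √(1 - ρ ^ 2) * q.2)) = T := by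
    ext q <;> simp [hT]
  rw [hTe]
  have : IsProbabilityMeasure (P.map (fun ω => (X ω, X' ω))) :=
    Measure.isProbabilityMeasure_map (hX.prodMk hX')
  have : IsProbabilityMeasure (((gaussianReal 0 1).prod (gaussianReal 0 1)).map T) :=
    Measure.isProbabilityMeasure_map (by fun_prop)
  refine Measure.ext_of_charFunDual (funext fun L => ?_)
  have hL : ∀ x y, L (x, y) = L (1, 0) * x + L (0, 1) * y := by
    intro x y
    have : ((x, y) : ℝ × ℝ) = x • (1, 0) + y • (0, 1) := by simp
    rw [this, map_add, map_smul, map_smul]; simp; ring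
  set a := L (1, 0)
  set b := L (0, 1)
  have hsq : √(1 - ρ ^ 2) ^ 2 = 1 - ρ ^ 2 := Real.sq_sqrt (by
    have := (sq_le_one_iff_abs_le_one ρ).2 hρ
    linarith)
  -- Ensures that `toNNReal` does not truncate the variance.
  have hv : 0 ≤ a ^ 2 + 2 * a * b * ρ + b ^ 2 := by
    have : a ^ 2 + 2 * a * b * ρ + b ^ 2 = (a + b * ρ) ^ 2 + (b * √(1 - ρ ^ 2)) ^ 2 := by
      rw [mul_pow b, hsq]; ring
    rw [this]; positivity
  rw [charFunDual_eq_charFun_map_one, AEMeasurable.map_map_of_aemeasurable (by fun_prop)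
    (hX.prodMk hX')]
  have e1 : (L ∘ fun ω => (X ω, X' ω)) = fun ω => a * X ω + b * X' ω := by
    ext ω; exact hL _ _
  rw [e1, (h a b).map_eq, charFun_gaussianReal, charFunDual_map, charFunDual_prod,
    charFunDual_eq_charFun_map_one, charFunDual_eq_charFun_map_one,
    gaussianReal_map_continuousLinearMap, gaussianReal_map_continuousLinearMap,
    charFun_gaussianReal, charFun_gaussianReal, ← Complex.exp_add]
  have e2 : ((L.comp T).comp (ContinuousLinearMap.inl ℝ ℝ ℝ)) 1 = a + b * ρ := by
    simp [hT, hL 1]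
  have e3 : ((L.comp T).comp (ContinuousLinearMap.inr ℝ ℝ ℝ)) 1 = b * √(1 - ρ ^ 2) := by
    simp [hT, hL 0]
  simp only [e2, e3]
  congr 1
  have e4 : ((((b * √(1 - ρ ^ 2)) ^ 2).toNNReal : ℝ) : ℂ) = b ^ 2 * (1 - ρ ^ 2) := by
    rw [Real.coe_toNNReal _ (sq_nonneg _), mul_pow, hsq]; push_cast; rfl
  simp only [map_zero, Real.coe_toNNReal _ hv, mul_one, Real.coe_toNNReal _ (sq_nonneg (a + b * ρ)),
    e4]
  push_cast
  ring

theorem integral_abs_rpow_mul_abs_rpow {p ρ : ℝ} (hρ : |ρ| ≤ 1) (hX : AEMeasurable X P)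
    (hX' : AEMeasurable X' P)
    (h : ∀ a b : ℝ, HasLaw (fun ω => a * X ω + b * X' ω)
      (gaussianReal 0 (a ^ 2 + 2 * a * b * ρ + b ^ 2).toNNReal) P) :
    ∫ ω, |X ω| ^ p * |X' ω| ^ p ∂P = jointAbsMoment p ρ := by
  have hm : Measurable fun q : ℝ × ℝ => |q.1| ^ p * |q.2| ^ p := by fun_prop
  have h1 := integral_map (f := fun q : ℝ × ℝ => |q.1| ^ p * |q.2| ^ p) (hX.prodMk hX')
    hm.aestronglyMeasurable
  rw [← h1, map_prodMk_eq_of_hasLaw hρ hX hX' h, integral_map (by fun_prop)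
    hm.aestronglyMeasurable]
  rfl

end GaussianMoments

/-! ### Covariance of absolute powers of Wiener integrals -/

section WienerMoments

variable {Ω : Type*} [MeasurableSpace Ω] {P : Measure Ω} {W : BorelSubset → Ω → ℝ}
  {f f' : ℝ × ℝ → ℝ} {X X' : Ω → ℝ} {p : ℝ}

theorem IsWienerIntegral.memLp_abs_rpow (hW : IsWhiteNoise P W) (h : IsWienerIntegral P W f X)
    (hp : 0 < p) : MemLp (fun ω => |X ω| ^ p) 2 P := by
  have := (h.hasLaw hW).hasGaussianLaw.memLp (p := ENNReal.ofReal p * 2) (by finiteness)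
  have := this.norm_rpow_div (ENNReal.ofReal p)
  rw [ENNReal.toReal_ofReal hp.le, mul_comm, ENNReal.mul_div_cancel_right (by simpa using hp)
    (by simp)] at this
  simpa using this

theorem IsWienerIntegral.integral_abs_rpow (hW : IsWhiteNoise P W)
    (h : IsWienerIntegral P W f X) (hf : ∫ z in bigSquare, f z ^ 2 = 1) :
    ∫ ω, |X ω| ^ p ∂P = gaussianAbsMoment p := by
  have hl := h.hasLaw hW
  have hm : Measurable fun x : ℝ => |x| ^ p := by fun_prop
  rw [hf, Real.toNNReal_one] at hl
  rw [gaussianAbsMoment, ← hl.map_eq, integral_map hl.aemeasurable hm.aestronglyMeasurable]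

/-- The covariance of absolute powers of normalized Wiener integrals. -/
theorem exists_abs_covariance_abs_rpow_le (hp : 0 < p) {η : ℝ} (hη : 0 < η) :
    ∃ C, 0 ≤ C ∧ ∀ {Ω : Type*} [MeasurableSpace Ω] {P : Measure Ω} {W : BorelSubset → Ω → ℝ}
      (_ : IsWhiteNoise P W) {f f' : ℝ × ℝ → ℝ} {X X' : Ω → ℝ}
      (_ : IsWienerIntegral P W f X) (_ : IsWienerIntegral P W f' X')
      (_ : ∫ z in bigSquare, f z ^ 2 = 1) (_ : ∫ z in bigSquare, f' z ^ 2 = 1),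
      |∫ ω, |X ω| ^ p * |X' ω| ^ p ∂P - gaussianAbsMoment p ^ 2| ≤
        η + C * |∫ z in bigSquare, f z * f' z| := by
  obtain ⟨C, hC, h⟩ := exists_abs_jointAbsMoment_sub_le hp hη
  -- `C` is fixed before the probability space and the integrands, so one constant serves every `n`,
  -- every pair of increments and every path of the volatility.
  refine ⟨C, hC, ?_⟩
  intro Ω _ P W hW f f' X X' hX hX' hf hf'
  have := hW.gaussian.isProbabilityMeasure
  set ρ := ∫ z in bigSquare, f z * f' z with hρ_def
  have hi1 := hX.memLp_integrand.integrable_sq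
  have hi2 := hX'.memLp_integrand.integrable_sq
  have hi3 := hX.memLp_integrand.integrable_mul hX'.memLp_integrand
  have hvar : ∀ a b : ℝ, ∫ z in bigSquare, (a * f z + b * f' z) ^ 2 =
      a ^ 2 + 2 * a * b * ρ + b ^ 2 := by
    intro a b
    have e : ∀ z, (a * f z + b * f' z) ^ 2 =
        a ^ 2 * f z ^ 2 + 2 * a * b * (f z * f' z) + b ^ 2 * f' z ^ 2 := by intro z; ring
    simp_rw [e]
    have hi3' : Integrable (fun z => f z * f' z) (volume.restrict bigSquare) := hi3
    rw [integral_add (by exact (hi1.const_mul _).add (hi3'.const_mul _)) (hi2.const_mul _),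
      integral_add (hi1.const_mul _) (hi3'.const_mul _)]
    simp only [integral_const_mul, hf, hf', ← hρ_def, mul_one]
  have hnn : ∀ a b : ℝ, 0 ≤ a ^ 2 + 2 * a * b * ρ + b ^ 2 := fun a b => by
    rw [← hvar]; exact integral_nonneg fun _ => sq_nonneg _
  -- Cauchy–Schwarz, read off from `2 ± 2ρ ≥ 0`.
  have hρ : |ρ| ≤ 1 := by
    rw [abs_le]; constructor
    · linarith [hnn 1 1]
    · linarith [hnn 1 (-1)]
  rw [integral_abs_rpow_mul_abs_rpow (p := p) hρ (hX.hasLaw hW).aemeasurable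
    (hX'.hasLaw hW).aemeasurable fun a b => ?_]
  · exact h ρ hρ
  · rw [← hvar]; exact (hX.linearComb hW hX' a b).hasLaw hW

end WienerMoments

/-! ### Lattice cells and counting -/

section Lattice

/-- The point `(ε i, ε j)` of the lattice of mesh `ε`. -/
def gridPoint (ε : ℝ) (q : ℕ × ℕ) : ℝ × ℝ := (ε * q.1, ε * q.2)

/-- The cell of the lattice of mesh `ε` with upper right corner `(ε i, ε j)`. -/
def gridCell (ε : ℝ) (q : ℕ × ℕ) : Set (ℝ × ℝ) :=
  Set.Ioc (ε * q.1 - ε) (ε * q.1) ×ˢ Set.Ioc (ε * q.2 - ε) (ε * q.2)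

theorem measurableSet_gridCell (ε : ℝ) (q : ℕ × ℕ) : MeasurableSet (gridCell ε q) :=
  measurableSet_Ioc.prod measurableSet_Ioc

theorem volume_gridCell {ε : ℝ} (hε : 0 < ε) (q : ℕ × ℕ) :
    volume (gridCell ε q) = ENNReal.ofReal (ε ^ 2) := by
  rw [gridCell, Measure.volume_eq_prod, Measure.prod_prod]
  simp [Real.volume_Ioc, sq, ENNReal.ofReal_mul hε.le]

theorem eq_of_mem_Ioc_mul {ε x : ℝ} (hε : 0 < ε) {i j : ℕ}
    (hi : x ∈ Set.Ioc (ε * i - ε) (ε * i)) (hj : x ∈ Set.Ioc (ε * j - ε) (ε * j)) : i = j := by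
  have key : ∀ {a b : ℕ}, ε * a - ε < x → x ≤ ε * b → a ≤ b := by
    intro a b h1 h2
    have : ε * a < ε * (b + 1) := by linarith
    have := lt_of_mul_lt_mul_left this hε.le
    exact Nat.lt_succ_iff.1 (by exact_mod_cast this)
  exact le_antisymm (key hi.1 hj.2) (key hj.1 hi.2)

theorem eq_of_mem_gridCell {ε : ℝ} (hε : 0 < ε) {q q' : ℕ × ℕ} {x : ℝ × ℝ}
    (h : x ∈ gridCell ε q) (h' : x ∈ gridCell ε q') : q = q' :=
  Prod.ext (eq_of_mem_Ioc_mul hε h.1 h'.1) (eq_of_mem_Ioc_mul hε h.2 h'.2)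

theorem dist_gridPoint_le {ε : ℝ} {q : ℕ × ℕ} {x : ℝ × ℝ} (h : x ∈ gridCell ε q) :
    dist x (gridPoint ε q) ≤ ε := by
  rw [Prod.dist_eq, max_le_iff, Real.dist_eq, Real.dist_eq, abs_le, abs_le]
  obtain ⟨⟨h1, h2⟩, h3, h4⟩ := h
  simp only [gridPoint]
  refine ⟨⟨?_, ?_⟩, ?_, ?_⟩ <;> linarith

/-- The number of lattice points in a translate of the `δ`-thickening of `F`. -/
theorem sq_mul_card_filter_le {F : Set (ℝ × ℝ)} (hF : Bornology.IsBounded F) {ε δ : ℝ}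
    (hε : 0 < ε) (hεδ : ε ≤ δ) (S : Finset (ℕ × ℕ)) (w : ℝ × ℝ)
    [DecidablePred fun q => gridPoint ε q - w ∈ Metric.cthickening δ F] :
    ε ^ 2 * (S.filter fun q => gridPoint ε q - w ∈ Metric.cthickening δ F).card ≤
      volume.real (Metric.cthickening (δ + δ) F) := by
  set T := S.filter fun q => gridPoint ε q - w ∈ Metric.cthickening δ F with hT
  have hδ : 0 ≤ δ := hε.le.trans hεδ
  -- Each counted point carries a cell of area `ε²` and diameter at most `δ` in the maximum metric.
  -- The cells are disjoint and fill part of a translate of the `2δ`-thickening.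
  have hsub : (⋃ q ∈ T, gridCell ε q) ⊆
      (fun x => x - w) ⁻¹' Metric.cthickening (δ + δ) F := by
    intro x hx
    simp only [Set.mem_iUnion] at hx
    obtain ⟨q, hq, hxq⟩ := hx
    refine Metric.cthickening_cthickening_subset hδ hδ F ?_
    refine Metric.mem_cthickening_of_dist_le (x - w) (gridPoint ε q - w) δ _
      (Finset.mem_filter.1 hq).2 ?_
    rw [dist_sub_right]
    exact (dist_gridPoint_le hxq).trans hεδ
  have hdisj : Set.PairwiseDisjoint (T : Set (ℕ × ℕ)) (gridCell ε) := by
    intro q _ q' _ hqq'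
    exact Set.disjoint_left.2 fun x h h' => hqq' (eq_of_mem_gridCell hε h h')
  have h1 : volume (⋃ q ∈ T, gridCell ε q) = T.card * ENNReal.ofReal (ε ^ 2) := by
    rw [measure_biUnion_finset hdisj fun q _ => measurableSet_gridCell ε q]
    simp [volume_gridCell hε]
  have h2 := measure_mono (μ := volume) hsub
  rw [h1, (measurePreserving_sub_right volume w).measure_preimage
    Metric.isClosed_cthickening.measurableSet.nullMeasurableSet] at h2
  have hfin : volume (Metric.cthickening (δ + δ) F) ≠ ∞ :=
    hF.cthickening.measure_lt_top.ne
  have := ENNReal.toReal_mono hfin h2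
  rw [ENNReal.toReal_mul, ENNReal.toReal_ofReal (by positivity)] at this
  simp only [ENNReal.toReal_natCast] at this
  rw [mul_comm]
  exact this

end Lattice

/-! ### Overlap of translated kernels -/

section Correlation

variable {H : ℝ × ℝ → ℝ}

theorem memLp_comp_sub_left (hH : MemLp H 2 volume) (z : ℝ × ℝ) :
    MemLp (fun w => H (z - w)) 2 volume :=
  hH.comp_measurePreserving (Measure.measurePreserving_sub_left volume z)

/-- Where both arguments lie in `G`, the product is at most half the sum of squares, and each square
keeps the indicator of the other argument, ready for counting. Elsewhere one factor belongs to the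
tail outside `G`, and a weighted inequality charges it there. -/
theorem integral_abs_mul_abs_le (hH : MemLp H 2 volume) {G : Set (ℝ × ℝ)} (hG : MeasurableSet G)
    {θ : ℝ} (hθ : 0 < θ) (z z' : ℝ × ℝ) :
    ∫ w, |H (z - w)| * |H (z' - w)| ≤
      1 / 2 * (∫ w, G.indicator 1 (z' - w) * H (z - w) ^ 2) +
      1 / 2 * (∫ w, G.indicator 1 (z - w) * H (z' - w) ^ 2) +
      (1 / θ * (∫ w in Gᶜ, H w ^ 2) + θ * ∫ w, H w ^ 2) := by
  classical
  have hI : ∀ z, Integrable (fun w => H (z - w) ^ 2) :=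
    fun z => (memLp_comp_sub_left hH z).integrable_sq
  have hind : ∀ (G : Set (ℝ × ℝ)) (_ : MeasurableSet G) (z z' : ℝ × ℝ),
      Integrable (fun w => G.indicator (1 : ℝ × ℝ → ℝ) (z' - w) * H (z - w) ^ 2) := by
    intro G hG z z'
    refine (hI z).bdd_mul (c := 1) ?_ (ae_of_all _ fun w => ?_)
    · exact ((measurable_one.indicator hG).comp (by fun_prop)).aestronglyMeasurable
    · rw [Set.indicator_apply]; split_ifs <;> simp
  have hT : ∀ z, ∫ w, Gᶜ.indicator (1 : ℝ × ℝ → ℝ) (z - w) * H (z - w) ^ 2 =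
      ∫ w in Gᶜ, H w ^ 2 := by
    intro z
    rw [integral_sub_left_eq_self (fun x => Gᶜ.indicator (1 : ℝ × ℝ → ℝ) x * H x ^ 2) volume z,
      ← integral_indicator hG.compl]
    congr 1 with w
    rw [Set.indicator_apply, Set.indicator_apply]
    split_ifs <;> simp
  have hC : ∀ z, ∫ w, H (z - w) ^ 2 = ∫ w, H w ^ 2 := fun z =>
    integral_sub_left_eq_self (fun x => H x ^ 2) volume z
  have hpt : ∀ w, |H (z - w)| * |H (z' - w)| ≤
      1 / 2 * (G.indicator 1 (z' - w) * H (z - w) ^ 2) +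
      1 / 2 * (G.indicator 1 (z - w) * H (z' - w) ^ 2) +
      (1 / (2 * θ) * (Gᶜ.indicator 1 (z - w) * H (z - w) ^ 2) +
       1 / (2 * θ) * (Gᶜ.indicator 1 (z' - w) * H (z' - w) ^ 2) +
       θ / 2 * H (z - w) ^ 2 + θ / 2 * H (z' - w) ^ 2) := by
    intro w
    -- Young's inequality. The large weight `1/θ` goes to the factor outside `G`, whose square will
    -- have a small integral.
    have key : ∀ a b : ℝ, |a| * |b| ≤ 1 / (2 * θ) * a ^ 2 + θ / 2 * b ^ 2 := by
      intro a b
      have : 1 / (2 * θ) * a ^ 2 + θ / 2 * b ^ 2 - |a| * |b| =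
          1 / (2 * θ) * (|a| - θ * |b|) ^ 2 := by
        rw [← sq_abs a, ← sq_abs b]
        field_simp
        ring
      have h0 : 0 ≤ 1 / (2 * θ) * (|a| - θ * |b|) ^ 2 := by positivity
      linarith
    have k1 := key (H (z - w)) (H (z' - w))
    have k2 := key (H (z' - w)) (H (z - w))
    have p1 : 0 ≤ 1 / (2 * θ) * H (z - w) ^ 2 := by positivity
    have p2 : 0 ≤ 1 / (2 * θ) * H (z' - w) ^ 2 := by positivity
    have p3 : 0 ≤ θ / 2 * H (z - w) ^ 2 := by positivity
    have p4 : 0 ≤ θ / 2 * H (z' - w) ^ 2 := by positivity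
    have p5 := sq_nonneg (H (z - w))
    have p6 := sq_nonneg (H (z' - w))
    have k3 : |H (z - w)| * |H (z' - w)| ≤ 1 / 2 * H (z - w) ^ 2 + 1 / 2 * H (z' - w) ^ 2 := by
      rw [← sq_abs (H (z - w)), ← sq_abs (H (z' - w))]
      nlinarith [sq_nonneg (|H (z - w)| - |H (z' - w)|)]
    by_cases h1 : z - w ∈ G <;> by_cases h2 : z' - w ∈ G <;>
      simp only [h1, h2, Set.indicator_of_mem, Set.indicator_of_notMem, Set.mem_compl_iff,
        not_true_eq_false, not_false_eq_true, Pi.one_apply, one_mul, zero_mul, mul_zero, add_zero,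
        zero_add] <;> linarith
  have i1 := (hind G hG z z').const_mul (1 / 2)
  have i2 := (hind G hG z' z).const_mul (1 / 2)
  have i3 := (hind Gᶜ hG.compl z z).const_mul (1 / (2 * θ))
  have i4 := (hind Gᶜ hG.compl z' z').const_mul (1 / (2 * θ))
  have i5 := (hI z).const_mul (θ / 2)
  have i6 := (hI z').const_mul (θ / 2)
  calc ∫ w, |H (z - w)| * |H (z' - w)| ≤ _ :=
        integral_mono_of_nonneg (ae_of_all _ fun w => by positivity)
          (by exact (i1.add i2).add (((i3.add i4).add i5).add i6)) (ae_of_all _ hpt)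
    _ = _ := by
      rw [integral_add (by exact i1.add i2) (by exact ((i3.add i4).add i5).add i6),
        integral_add i1 i2, integral_add (by exact (i3.add i4).add i5) i6,
        integral_add (by exact i3.add i4) i5, integral_add i3 i4]
      simp only [integral_const_mul, hT, hC]
      ring

/-- With the sum taken inside the integral, each `w` meets the indicator as often as there are
lattice points in `w` plus the thickening; `sq_mul_card_filter_le` counts them. -/
theorem sum_integral_indicator_le (hH : MemLp H 2 volume) {F : Set (ℝ × ℝ)}
    (hF : Bornology.IsBounded F) {ε δ : ℝ} (hε : 0 < ε) (hεδ : ε ≤ δ) (S : Finset (ℕ × ℕ))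
    (z : ℝ × ℝ) :
    ε ^ 2 * ∑ q ∈ S, ∫ w, (Metric.cthickening δ F).indicator 1 (gridPoint ε q - w) * H (z - w) ^ 2
      ≤ volume.real (Metric.cthickening (δ + δ) F) * ∫ w, H w ^ 2 := by
  classical
  set G := Metric.cthickening δ F
  have hG : MeasurableSet G := Metric.isClosed_cthickening.measurableSet
  have hI : Integrable (fun w => H (z - w) ^ 2) := (memLp_comp_sub_left hH z).integrable_sq
  have hind : ∀ z', Integrable (fun w => G.indicator (1 : ℝ × ℝ → ℝ) (z' - w) * H (z - w) ^ 2) := by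
    intro z'
    refine hI.bdd_mul (c := 1) ?_ (ae_of_all _ fun w => ?_)
    · exact ((measurable_one.indicator hG).comp (by fun_prop)).aestronglyMeasurable
    · rw [Set.indicator_apply]; split_ifs <;> simp
  rw [← integral_finsetSum _ fun q _ => hind _, ← integral_const_mul,
    ← integral_sub_left_eq_self (fun x => H x ^ 2) volume z, ← integral_const_mul]
  refine integral_mono ((integrable_finsetSum _ fun q _ => hind _).const_mul _)
    (hI.const_mul _) fun w => ?_
  simp only
  rw [← Finset.sum_mul, ← mul_assoc]
  refine mul_le_mul_of_nonneg_right ?_ (sq_nonneg _)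
  refine le_trans (le_of_eq ?_) (sq_mul_card_filter_le hF hε hεδ S w)
  congr 1
  simp only [Set.indicator_apply, Pi.one_apply]
  rw [Finset.sum_ite]
  simp [G]

/-- In the near part one summation uses the counting bound and the other only `hS`. The tail and the
`θ` term do not depend on the pair, so `hS` used twice suffices. -/
theorem sum_sum_integral_abs_mul_abs_le (hH : MemLp H 2 volume) {F : Set (ℝ × ℝ)}
    (hF : Bornology.IsBounded F) {ε δ θ : ℝ} (hε : 0 < ε) (hεδ : ε ≤ δ) (hθ : 0 < θ)
    (S : Finset (ℕ × ℕ)) (hS : ε ^ 2 * S.card ≤ 1) :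
    ε ^ 4 * ∑ q ∈ S, ∑ q' ∈ S, ∫ w, |H (gridPoint ε q - w)| * |H (gridPoint ε q' - w)| ≤
      (volume.real (Metric.cthickening (δ + δ) F) + θ) * (∫ w, H w ^ 2) +
        1 / θ * ∫ w in (Metric.cthickening δ F)ᶜ, H w ^ 2 := by
  set G := Metric.cthickening δ F
  have hG : MeasurableSet G := Metric.isClosed_cthickening.measurableSet
  set V := volume.real (Metric.cthickening (δ + δ) F)
  set c := ∫ w, H w ^ 2
  set T := ∫ w in Gᶜ, H w ^ 2
  set B : ℕ × ℕ → ℕ × ℕ → ℝ := fun q q' =>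
    ∫ w, G.indicator 1 (gridPoint ε q' - w) * H (gridPoint ε q - w) ^ 2
  have hB : ∀ q, ε ^ 2 * ∑ q' ∈ S, B q q' ≤ V * c := fun q =>
    sum_integral_indicator_le hH hF hε hεδ S _
  have hc : 0 ≤ c := integral_nonneg fun _ => sq_nonneg _
  have hT : 0 ≤ T := integral_nonneg fun _ => sq_nonneg _
  have hV : 0 ≤ V := measureReal_nonneg
  have hm : 0 ≤ ε ^ 2 * S.card := by positivity
  have hBB : ε ^ 4 * ∑ q ∈ S, ∑ q' ∈ S, B q q' ≤ V * c := by
    calc ε ^ 4 * ∑ q ∈ S, ∑ q' ∈ S, B q q' = ε ^ 2 * ∑ q ∈ S, ε ^ 2 * ∑ q' ∈ S, B q q' := by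
          rw [← Finset.mul_sum]; ring
      _ ≤ ε ^ 2 * ∑ q ∈ S, V * c := by
          exact mul_le_mul_of_nonneg_left (Finset.sum_le_sum fun q _ => hB q) (by positivity)
      _ = (ε ^ 2 * S.card) * (V * c) := by simp; ring
      _ ≤ 1 * (V * c) := by gcongr
      _ = V * c := one_mul _
  calc _ ≤ ε ^ 4 * ∑ q ∈ S, ∑ q' ∈ S,
        (1 / 2 * B q q' + 1 / 2 * B q' q + (1 / θ * T + θ * c)) := by
          gcongr with q _ q' _
          exact integral_abs_mul_abs_le hH hG hθ _ _
    _ = 1 / 2 * (ε ^ 4 * ∑ q ∈ S, ∑ q' ∈ S, B q q') +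
        1 / 2 * (ε ^ 4 * ∑ q ∈ S, ∑ q' ∈ S, B q' q) +
        (ε ^ 2 * S.card) ^ 2 * (1 / θ * T + θ * c) := by
          simp only [Finset.sum_add_distrib, ← Finset.mul_sum, Finset.sum_const, nsmul_eq_mul]
          ring
    _ ≤ 1 / 2 * (V * c) + 1 / 2 * (V * c) + 1 * (1 / θ * T + θ * c) := by
          have h2 : ε ^ 4 * ∑ q ∈ S, ∑ q' ∈ S, B q' q ≤ V * c := by
            rw [Finset.sum_comm]; exact hBB
          gcongr
          exact pow_le_one₀ hm hS
    _ = _ := by ring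

end Correlation

/-! ### The increment kernel and its concentration measure -/

section Kernel

variable {g : ℝ × ℝ → ℝ} {π : Measure (ℝ × ℝ)}

/-- The essential support is defined by an uncountable union of open sets; locally null sets are
null because the plane is second countable. -/
theorem IsWeightFunction.ae_eq_zero (hg : IsWeightFunction g) :
    ∀ᵐ z : ℝ × ℝ, z ∉ unitSquare → g z = 0 := by
  have h : volume {z : ℝ × ℝ | z ∉ unitSquare ∧ g z ≠ 0} = 0 := by
    refine measure_null_of_locally_null _ fun x hx => ?_
    have hx' : x ∉ essSupport g := fun h => hx.1 (hg.essSupport_subset h)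
    simp only [essSupport, Set.mem_compl_iff, not_not, Set.mem_sUnion] at hx'
    obtain ⟨U, ⟨hU, hgU⟩, hxU⟩ := hx'
    refine ⟨{z | z ∉ unitSquare ∧ g z ≠ 0} ∩ U,
      inter_mem_nhdsWithin _ (hU.mem_nhds hxU), ?_⟩
    rw [ae_restrict_iff' hU.measurableSet] at hgU
    refine measure_mono_null (fun z hz => ?_) hgU
    exact fun h => hz.1.2 (h hz.2)
  refine measure_mono_null (fun z hz => ?_) h
  simpa using hz

theorem incrementKernel_eq (g : ℝ × ℝ → ℝ) (n : ℕ) (z : ℝ × ℝ) :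
    incrementKernel g n z = g z - g (z - (1 / (n : ℝ), 0)) - g (z - (0, 1 / (n : ℝ))) +
      g (z - (1 / (n : ℝ), 1 / (n : ℝ))) := by
  have h : ∀ a b : ℝ, z - (a, b) = (z.1 - a, z.2 - b) := fun a b => rfl
  simp only [incrementKernel, h, sub_zero]

theorem memLp_incrementKernel (hg : MemLp g 2 volume) (n : ℕ) :
    MemLp (incrementKernel g n) 2 volume := by
  have h : ∀ a : ℝ × ℝ, MemLp (fun z => g (z - a)) 2 volume := fun a =>
    hg.comp_measurePreserving (measurePreserving_sub_right volume a)
  have := ((hg.sub (h (1 / (n : ℝ), 0))).sub (h (0, 1 / (n : ℝ)))).add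
    (h (1 / (n : ℝ), 1 / (n : ℝ)))
  exact this.ae_eq (ae_of_all _ fun z => (incrementKernel_eq g n z).symm)

theorem IsWeightFunction.ae_incrementKernel_eq_zero (hg : IsWeightFunction g) (n : ℕ) :
    ∀ᵐ z : ℝ × ℝ, z ∉ Set.Icc ((0 : ℝ), (0 : ℝ)) (1 + 1 / (n : ℝ), 1 + 1 / (n : ℝ)) →
      incrementKernel g n z = 0 := by
  have h : ∀ a : ℝ × ℝ, ∀ᵐ z : ℝ × ℝ, z - a ∉ unitSquare → g (z - a) = 0 := fun a =>
    (measurePreserving_sub_right volume a).quasiMeasurePreserving.ae hg.ae_eq_zero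
  have hn : 0 ≤ 1 / (n : ℝ) := by positivity
  filter_upwards [hg.ae_eq_zero, h (1 / (n : ℝ), 0), h (0, 1 / (n : ℝ)),
    h (1 / (n : ℝ), 1 / (n : ℝ))] with z h1 h2 h3 h4 hz
  rw [incrementKernel_eq, h1, h2, h3, h4]
  · simp
  all_goals
    refine fun hmem => hz ?_
    simp only [unitSquare, Set.mem_Icc, Prod.le_def, Prod.fst_sub, Prod.snd_sub] at hmem ⊢
    obtain ⟨⟨a1, a2⟩, a3, a4⟩ := hmem
    refine ⟨⟨?_, ?_⟩, ?_, ?_⟩ <;> linarith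

theorem scaling_nonneg (g : ℝ × ℝ → ℝ) (n : ℕ) : 0 ≤ scaling g n :=
  integral_nonneg fun _ => sq_nonneg _

theorem integral_concentrationMeasure (hg : MemLp g 2 volume) (n : ℕ) (f : ℝ × ℝ → ℝ) :
    ∫ z, f z ∂(concentrationMeasure g n) =
      (∫ z, f z * incrementKernel g n z ^ 2) / scaling g n := by
  have hm := (memLp_incrementKernel hg n).1.aemeasurable
  rw [concentrationMeasure, integral_withDensity_eq_integral_toReal_smul₀
    (by fun_prop) (ae_of_all _ fun _ => by simp), ← integral_div]
  congr 1 with z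
  rw [ENNReal.toReal_ofReal (div_nonneg (sq_nonneg _) (scaling_nonneg g n)), smul_eq_mul]
  ring

/-- If `c_n = 0`, division by zero makes `π_n` the zero measure, whereas the total masses must tend
to one. -/
theorem eventually_scaling_pos [IsProbabilityMeasure π] (hg : MemLp g 2 volume)
    (hπ : ConvergesWeakly (concentrationMeasure g) π) : ∀ᶠ n in atTop, 0 < scaling g n := by
  have h := hπ 1
  simp only [BoundedContinuousFunction.coe_one, Pi.one_apply] at h
  simp only [integral_concentrationMeasure hg, integral_const, probReal_univ, smul_eq_mul,
    mul_one] at h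
  filter_upwards [h.eventually_ne one_ne_zero] with n hn
  refine (scaling_nonneg g n).lt_of_ne fun h0 => hn ?_
  rw [← h0, div_zero]

theorem isProbabilityMeasure_concentrationMeasure (hg : MemLp g 2 volume) {n : ℕ}
    (hn : 0 < scaling g n) : IsProbabilityMeasure (concentrationMeasure g n) := by
  constructor
  rw [concentrationMeasure, withDensity_apply _ MeasurableSet.univ, Measure.restrict_univ,
    ← ofReal_integral_eq_lintegral_ofReal ((memLp_incrementKernel hg n).integrable_sq.div_const _)
      (ae_of_all _ fun z => div_nonneg (sq_nonneg _) hn.le), integral_div, ← scaling,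
    div_self hn.ne', ENNReal.ofReal_one]

theorem unitSquare_nonempty : unitSquare.Nonempty := ⟨(0, 0), by simp [unitSquare]⟩

theorem isCompact_unitSquare : IsCompact unitSquare := isCompact_Icc

/-- The bounded continuous function `min 1 (dist(·, F) / δ)`. -/
noncomputable def truncatedDist (F : Set (ℝ × ℝ)) (δ : ℝ) : (ℝ × ℝ) →ᵇ ℝ :=
  BoundedContinuousFunction.ofNormedAddCommGroup (fun z => min 1 (|Metric.infDist z F / δ|))
    (continuous_const.min ((Metric.continuous_infDist_pt F).div_const δ).abs) 1 (by
      intro z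
      rw [Real.norm_of_nonneg (le_min zero_le_one (abs_nonneg _))]
      exact min_le_left _ _)

theorem truncatedDist_apply (F : Set (ℝ × ℝ)) (δ : ℝ) (z : ℝ × ℝ) :
    truncatedDist F δ z = min 1 (|Metric.infDist z F / δ|) := rfl

theorem truncatedDist_nonneg (F : Set (ℝ × ℝ)) (δ : ℝ) (z : ℝ × ℝ) : 0 ≤ truncatedDist F δ z :=
  le_min zero_le_one (abs_nonneg _)

theorem infDist_unitSquare_le {z : ℝ × ℝ} {r : ℝ} (hr : 0 ≤ r)
    (hz : z ∈ Set.Icc ((0 : ℝ), (0 : ℝ)) (1 + r, 1 + r)) : Metric.infDist z unitSquare ≤ r := by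
  obtain ⟨⟨h1, h2⟩, h3, h4⟩ := hz
  simp only at h1 h2 h3 h4
  have hmem : (min z.1 1, min z.2 1) ∈ unitSquare :=
    ⟨⟨le_min h1 zero_le_one, le_min h2 zero_le_one⟩, min_le_right _ _, min_le_right _ _⟩
  refine (Metric.infDist_le_dist_of_mem hmem).trans ?_
  have key : ∀ x : ℝ, x ≤ 1 + r → dist x (min x 1) ≤ r := by
    intro x hx
    rw [Real.dist_eq, abs_of_nonneg (sub_nonneg.2 (min_le_left _ _))]
    rcases min_cases x 1 with h | h <;> rw [h.1] <;> linarith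
  rw [Prod.dist_eq, max_le_iff]
  exact ⟨key _ h3, key _ h4⟩

/-- `π_n` is carried by the `1/n`-neighbourhood of the closed unit square. Testing weak convergence
with the truncated distance to the square shows that this distance vanishes `π`-almost everywhere.
-/
theorem measure_compl_unitSquare_eq_zero [IsProbabilityMeasure π] (hg : IsWeightFunction g)
    (hπ : ConvergesWeakly (concentrationMeasure g) π) : π unitSquareᶜ = 0 := by
  have hlim : Tendsto (fun n => ∫ z, truncatedDist unitSquare 1 z ∂(concentrationMeasure g n))
      atTop (𝓝 0) := by
    refine squeeze_zero' (Eventually.of_forall fun n =>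
      integral_nonneg fun z => truncatedDist_nonneg _ _ _) ?_ tendsto_one_div_atTop_nhds_zero_nat
    filter_upwards [eventually_scaling_pos hg.memLp hπ] with n hn
    rw [integral_concentrationMeasure hg.memLp, div_le_iff₀ hn, scaling, ← integral_const_mul]
    have hI := (memLp_incrementKernel hg.memLp n).integrable_sq
    refine integral_mono_of_nonneg (ae_of_all _ fun z =>
      mul_nonneg (truncatedDist_nonneg _ _ _) (sq_nonneg _)) (hI.const_mul _) ?_
    filter_upwards [hg.ae_incrementKernel_eq_zero n] with z hz
    by_cases h : z ∈ Set.Icc ((0 : ℝ), (0 : ℝ)) (1 + 1 / (n : ℝ), 1 + 1 / (n : ℝ))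
    · refine mul_le_mul_of_nonneg_right ?_ (sq_nonneg _)
      rw [truncatedDist_apply, div_one, abs_of_nonneg Metric.infDist_nonneg]
      exact (min_le_right _ _).trans (infDist_unitSquare_le (by positivity) h)
    · simp [hz h]
  have h0 := tendsto_nhds_unique (hπ (truncatedDist unitSquare 1)) hlim
  rw [integral_eq_zero_iff_of_nonneg (fun z => truncatedDist_nonneg _ _ _)
    (BoundedContinuousFunction.integrable _ _)] at h0
  refine measure_mono_null (fun z hz => ?_) h0
  intro h
  change truncatedDist unitSquare 1 z = 0 at h
  rw [truncatedDist_apply] at h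
  refine hz ?_
  rw [isCompact_unitSquare.isClosed.mem_iff_infDist_zero unitSquare_nonempty]
  by_contra h'
  have : 0 < |Metric.infDist z unitSquare / 1| := by simpa using h'
  exact (lt_min one_pos this).ne h.symm

/-- The set of lattice indices contributing to the power variation at `z`. -/
noncomputable def gridIndex (ε : ℝ) (z : ℝ × ℝ) : Finset (ℕ × ℕ) :=
  Finset.Icc 1 ⌊z.1 / ε⌋₊ ×ˢ Finset.Icc 1 ⌊z.2 / ε⌋₊

theorem sq_mul_card_gridIndex_le {ε : ℝ} (hε : 0 < ε) {z : ℝ × ℝ} (hz : z ∈ unitSquare) :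
    ε ^ 2 * (gridIndex ε z).card ≤ 1 := by
  obtain ⟨⟨h1, h2⟩, h3, h4⟩ := hz
  simp only at h1 h2 h3 h4
  have key : ∀ x : ℝ, 0 ≤ x → x ≤ 1 → ε * ⌊x / ε⌋₊ ≤ 1 := by
    intro x hx hx1
    have := Nat.floor_le (div_nonneg hx hε.le)
    rw [le_div_iff₀ hε] at this
    linarith
  simp only [gridIndex, Finset.card_product, Nat.card_Icc, add_tsub_cancel_right]
  push_cast
  calc ε ^ 2 * (⌊z.1 / ε⌋₊ * ⌊z.2 / ε⌋₊ : ℝ) = (ε * ⌊z.1 / ε⌋₊) * (ε * ⌊z.2 / ε⌋₊) := by ring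
    _ ≤ 1 * 1 := by
      gcongr
      · exact key _ h1 h3
      · exact key _ h2 h4
    _ = 1 := one_mul 1

/-- The averaged correlation between the increments of the ambit field vanishes asymptotically. -/
theorem tendsto_correlation_sum [IsProbabilityMeasure π] (hg : IsWeightFunction g)
    (hπ_null : volume π.support = 0) (hπ : ConvergesWeakly (concentrationMeasure g) π)
    {ε : ℕ → ℝ} (hε_pos : ∀ᶠ n in atTop, 0 < ε n) (hε : Tendsto ε atTop (𝓝 0))
    {z : ℝ × ℝ} (hz : z ∈ unitSquare) :
    Tendsto (fun n => ε n ^ 4 * ∑ q ∈ gridIndex (ε n) z, ∑ q' ∈ gridIndex (ε n) z,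
      (∫ w, |incrementKernel g n (gridPoint (ε n) q - w)| *
        |incrementKernel g n (gridPoint (ε n) q' - w)|) / scaling g n) atTop (𝓝 0) := by
  have hsq : π unitSquareᶜ = 0 := measure_compl_unitSquare_eq_zero hg hπ
  have hne : π.support.Nonempty := Measure.nonempty_support (IsProbabilityMeasure.ne_zero π)
  have hsupp : π.support ⊆ unitSquare :=
    Measure.support_subset_of_isClosed isCompact_unitSquare.isClosed hsq
  have hb : Bornology.IsBounded π.support := isCompact_unitSquare.isBounded.subset hsupp
  set F := π.support with hF
  -- The support is closed and bounded, so the areas of its thickenings shrink to its own area,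
  -- which is zero.
  have hvol : Tendsto (fun δ => volume (Metric.cthickening δ F)) (𝓝 0) (𝓝 (volume F)) :=
    tendsto_measure_cthickening_of_isClosed ⟨1, one_pos, hb.cthickening.measure_lt_top.ne⟩
      Measure.isClosed_support
  rw [hπ_null] at hvol
  refine tendsto_order.2 ⟨fun a ha => Eventually.of_forall fun n => ha.trans_le ?_, fun a ha => ?_⟩
  · have := scaling_nonneg g n
    refine mul_nonneg (by positivity) (Finset.sum_nonneg fun q _ => Finset.sum_nonneg fun q' _ =>
      div_nonneg (integral_nonneg fun w => by positivity) this)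
  obtain ⟨δ, hδ, hVδ⟩ : ∃ δ > 0, volume.real (Metric.cthickening (δ + δ) F) < a / 3 := by
    have h1 : ∀ᶠ δ in 𝓝 (0 : ℝ), volume (Metric.cthickening δ F) < ENNReal.ofReal (a / 3) :=
      hvol.eventually_lt_const (by simpa using ha)
    obtain ⟨r, hr, h2⟩ := Metric.eventually_nhds_iff.1 h1
    refine ⟨r / 4, by positivity, ?_⟩
    have := h2 (y := r / 4 + r / 4) (by
      rw [Real.dist_eq, sub_zero, abs_of_pos (by positivity)]; linarith)
    exact (ENNReal.lt_ofReal_iff_toReal_lt hb.cthickening.measure_lt_top.ne).1 this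
  -- Three terms share the bound `a`: the area of the thickening, the Young weight `θ`, and the tail
  -- divided by `θ`. The tail is therefore asked to be below `θ²`.
  set θ := a / 3
  have hθ : 0 < θ := by positivity
  have hlim : Tendsto (fun n => ∫ z, truncatedDist F δ z ∂(concentrationMeasure g n)) atTop
      (𝓝 0) := by
    have h0 : ∫ z, truncatedDist F δ z ∂π = 0 := by
      refine integral_eq_zero_of_ae ?_
      filter_upwards [Measure.support_mem_ae (μ := π)] with z hz
      rw [truncatedDist_apply, Metric.infDist_zero_of_mem hz]
      simp
    simpa [h0] using hπ (truncatedDist F δ)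
  filter_upwards [eventually_scaling_pos hg.memLp hπ, hε_pos, hε.eventually_lt_const hδ,
    hlim.eventually_lt_const (show 0 < θ * θ by positivity)] with n hc hεn hεδ hT
  set H := incrementKernel g n
  set c := scaling g n
  have hH : MemLp H 2 volume := memLp_incrementKernel hg.memLp n
  have hmain := sum_sum_integral_abs_mul_abs_le hH hb hεn hεδ.le hθ (gridIndex (ε n) z)
    (sq_mul_card_gridIndex_le hεn hz)
  -- Outside the thickening `truncatedDist F δ` equals one, so its integral dominates the tail.
  have hT' : (∫ w in (Metric.cthickening δ F)ᶜ, H w ^ 2) < θ * θ * c := by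
    rw [integral_concentrationMeasure hg.memLp, div_lt_iff₀ hc] at hT
    refine lt_of_le_of_lt ?_ hT
    rw [← integral_indicator Metric.isClosed_cthickening.measurableSet.compl]
    refine integral_mono_of_nonneg (ae_of_all _ fun w => ?_) ?_ (ae_of_all _ fun w => ?_)
    · exact Set.indicator_nonneg (fun _ _ => sq_nonneg _) _
    · refine hH.integrable_sq.bdd_mul (c := 1)
        (truncatedDist F δ).continuous.aestronglyMeasurable (ae_of_all _ fun w => ?_)
      rw [Real.norm_of_nonneg (truncatedDist_nonneg _ _ _)]
      exact min_le_left _ _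
    · by_cases hw : w ∈ (Metric.cthickening δ F)ᶜ
      · rw [Set.indicator_of_mem hw]
        refine le_mul_of_one_le_left (sq_nonneg _) ?_
        rw [truncatedDist_apply]
        refine le_min le_rfl ?_
        have : δ < Metric.infDist w F := by
          by_contra h'
          refine hw (Metric.mem_cthickening_iff.2 ?_)
          exact (ENNReal.le_ofReal_iff_toReal_le (Metric.infEDist_ne_top hne) hδ.le).2
            (not_lt.1 h')
        rw [abs_of_nonneg (div_nonneg Metric.infDist_nonneg hδ.le), le_div_iff₀ hδ]
        linarith
      · rw [Set.indicator_of_notMem hw]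
        exact mul_nonneg (truncatedDist_nonneg _ _ _) (sq_nonneg _)
  simp only [← Finset.sum_div]
  rw [← mul_div_assoc, div_lt_iff₀ hc]
  refine hmain.trans_lt ?_
  have e : (∫ w, H w ^ 2) = c := rfl
  rw [e]
  have h1 : 1 / θ * (∫ w in (Metric.cthickening δ F)ᶜ, H w ^ 2) < θ * c := by
    rw [one_div, inv_mul_lt_iff₀ hθ]; linarith
  have h2 : volume.real (Metric.cthickening (δ + δ) F) * c < θ * c := by gcongr
  have h3 : a = θ + θ + θ := by simp only [θ]; ring
  rw [h3]
  linarith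

end Kernel

/-! ### Riemann sums with varying integrands -/

section Riemann

theorem gridCell_subset {ε : ℝ} (hε : 0 < ε) {z : ℝ × ℝ} (hz : z ∈ unitSquare) {q : ℕ × ℕ}
    (hq : q ∈ gridIndex ε z) : gridCell ε q ⊆ Set.Ioc 0 z.1 ×ˢ Set.Ioc 0 z.2 := by
  obtain ⟨⟨h1, h2⟩, -, -⟩ := hz
  simp only [gridIndex, Finset.mem_product, Finset.mem_Icc] at hq
  have key : ∀ {x : ℝ} {i : ℕ}, 0 ≤ x → 1 ≤ i → i ≤ ⌊x / ε⌋₊ →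
      Set.Ioc (ε * i - ε) (ε * i) ⊆ Set.Ioc 0 x := by
    intro x i hx hi hi'
    have hi1 : (1 : ℝ) ≤ i := by exact_mod_cast hi
    have h := (Nat.le_floor_iff (div_nonneg hx hε.le)).1 hi'
    rw [le_div_iff₀ hε] at h
    refine Set.Ioc_subset_Ioc ?_ (by linarith)
    nlinarith
  exact Set.prod_mono (key h1 hq.1.1 hq.1.2) (key h2 hq.2.1 hq.2.2)

/-- The indexed cells may miss a strip of width less than `ε` along the upper and right edges. Cells
are closed on the right, hence the ceiling. -/
theorem exists_mem_gridCell {ε : ℝ} (hε : 0 < ε) {z x : ℝ × ℝ}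
    (hx : x ∈ Set.Ioo 0 z.1 ×ˢ Set.Ioo 0 z.2) (h1 : ε ≤ z.1 - x.1) (h2 : ε ≤ z.2 - x.2) :
    ∃ q ∈ gridIndex ε z, x ∈ gridCell ε q := by
  have key : ∀ {s u : ℝ}, u ∈ Set.Ioo 0 s → ε ≤ s - u →
      ⌈u / ε⌉₊ ∈ Finset.Icc 1 ⌊s / ε⌋₊ ∧
        u ∈ Set.Ioc (ε * ⌈u / ε⌉₊ - ε) (ε * ⌈u / ε⌉₊) := by
    intro s u hu hs
    have hpos : 0 < u / ε := div_pos hu.1 hε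
    have h3 := Nat.le_ceil (u / ε)
    have h4 := Nat.ceil_lt_add_one hpos.le
    refine ⟨Finset.mem_Icc.2 ⟨Nat.one_le_iff_ne_zero.2 (Nat.ceil_pos.2 hpos).ne', ?_⟩, ?_, ?_⟩
    · refine Nat.le_floor (h4.le.trans ?_)
      rw [← sub_nonneg]
      have : s / ε - (u / ε + 1) = (s - u - ε) / ε := by field_simp; ring
      rw [this]
      exact div_nonneg (by linarith) hε.le
    · have : ε * ⌈u / ε⌉₊ < ε * (u / ε + 1) := by gcongr
      have e : ε * (u / ε + 1) = u + ε := by field_simp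
      linarith
    · have : ε * (u / ε) ≤ ε * ⌈u / ε⌉₊ := by gcongr
      rwa [mul_div_cancel₀ _ hε.ne'] at this
  exact ⟨(⌈x.1 / ε⌉₊, ⌈x.2 / ε⌉₊),
    Finset.mem_product.2 ⟨(key hx.1 h1).1, (key hx.2 h2).1⟩, (key hx.1 h1).2, (key hx.2 h2).2⟩

/-- The sum is the integral of a step function whose value at `x` is `β n` at the corner of the cell
containing `x`. Those corners tend to `x`, so the continuous convergence in `hβ` gives pointwise
limits, and dominated convergence applies. -/
theorem tendsto_riemann_sum {β : ℕ → ℝ × ℝ → ℝ} {b : ℝ × ℝ → ℝ} {C : ℝ}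
    (hβ : ∀ (x : ℝ × ℝ) (u : ℕ → ℝ × ℝ), Tendsto u atTop (𝓝 x) →
      Tendsto (fun n => β n (u n)) atTop (𝓝 (b x)))
    (hC : ∀ᶠ n in atTop, ∀ x, |β n x| ≤ C) {ε : ℕ → ℝ} (hε_pos : ∀ᶠ n in atTop, 0 < ε n)
    (hε : Tendsto ε atTop (𝓝 0)) {z : ℝ × ℝ} (hz : z ∈ unitSquare) :
    Tendsto (fun n => ε n ^ 2 * ∑ q ∈ gridIndex (ε n) z, β n (gridPoint (ε n) q)) atTop
      (𝓝 (∫ x in Set.Ioc 0 z.1 ×ˢ Set.Ioc 0 z.2, b x)) := by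
  classical
  set R : Set (ℝ × ℝ) := Set.Ioc 0 z.1 ×ˢ Set.Ioc 0 z.2 with hR
  have hRm : MeasurableSet R := measurableSet_Ioc.prod measurableSet_Ioc
  have hRfin : volume R ≠ ∞ := by
    rw [hR, Measure.volume_eq_prod, Measure.prod_prod]
    simp only [Real.volume_Ioc]
    finiteness
  set G : ℕ → ℝ × ℝ → ℝ := fun n x => ∑ q ∈ gridIndex (ε n) z,
    (gridCell (ε n) q).indicator (fun _ => β n (gridPoint (ε n) q)) x with hG
  have hGeq : ∀ n, 0 < ε n → ∀ q ∈ gridIndex (ε n) z, ∀ x ∈ gridCell (ε n) q,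
      G n x = β n (gridPoint (ε n) q) := by
    intro n hn q hq x hx
    simp only [hG]
    rw [Finset.sum_eq_single q]
    · exact Set.indicator_of_mem hx _
    · intro q' _ hne
      exact Set.indicator_of_notMem (fun h => hne (eq_of_mem_gridCell hn h hx)) _
    · exact fun h => absurd hq h
  have hG0 : ∀ n x, (∀ q ∈ gridIndex (ε n) z, x ∉ gridCell (ε n) q) → G n x = 0 := by
    intro n x h
    exact Finset.sum_eq_zero fun q hq => Set.indicator_of_notMem (h q hq) _
  have hInt : ∀ᶠ n in atTop, ∫ x, G n x =
      ε n ^ 2 * ∑ q ∈ gridIndex (ε n) z, β n (gridPoint (ε n) q) := by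
    filter_upwards [hε_pos] with n hn
    simp only [hG]
    rw [integral_finsetSum _ fun q _ => ?_, Finset.mul_sum]
    · refine Finset.sum_congr rfl fun q _ => ?_
      rw [integral_indicator (measurableSet_gridCell _ _), setIntegral_const, Measure.real,
        volume_gridCell hn, ENNReal.toReal_ofReal (by positivity), smul_eq_mul]
    · refine (integrable_indicator_iff (measurableSet_gridCell _ _)).2 ?_
      refine integrableOn_const ?_
      rw [volume_gridCell hn]; simp
  rw [← integral_indicator hRm]
  refine Tendsto.congr' hInt ?_
  refine tendsto_integral_filter_of_dominated_convergence (R.indicator fun _ => |C|)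
    (Eventually.of_forall fun n => ?_) ?_ ?_ ?_
  · refine Measurable.aestronglyMeasurable ?_
    exact Finset.measurable_sum _ fun q _ =>
      measurable_const.indicator (measurableSet_gridCell _ _)
  · filter_upwards [hC, hε_pos] with n hn hεn
    refine ae_of_all _ fun x => ?_
    by_cases h : ∃ q ∈ gridIndex (ε n) z, x ∈ gridCell (ε n) q
    · obtain ⟨q, hq, hx⟩ := h
      rw [hGeq n hεn q hq x hx, Set.indicator_of_mem (gridCell_subset hεn hz hq hx)]
      exact (hn _).trans (le_abs_self C)
    · push Not at h
      rw [hG0 n x h, norm_zero]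
      exact Set.indicator_nonneg (fun _ _ => abs_nonneg C) _
  · exact (integrable_indicator_iff hRm).2 (integrableOn_const hRfin)
  · have hae : (Set.Ioo 0 z.1 ×ˢ Set.Ioo 0 z.2 : Set (ℝ × ℝ)) =ᵐ[volume] R :=
      Measure.set_prod_ae_eq Ioo_ae_eq_Ioc Ioo_ae_eq_Ioc
    filter_upwards [hae.mem_iff] with x hx
    by_cases hxR : x ∈ R
    · rw [Set.indicator_of_mem hxR]
      have hxo := hx.2 hxR
      have h1 : 0 < z.1 - x.1 := sub_pos.2 hxo.1.2
      have h2 : 0 < z.2 - x.2 := sub_pos.2 hxo.2.2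
      have hex : ∀ᶠ n in atTop, ∃ q ∈ gridIndex (ε n) z, x ∈ gridCell (ε n) q := by
        filter_upwards [hε_pos, hε.eventually_le_const h1, hε.eventually_le_const h2]
          with n hn hn1 hn2
        exact exists_mem_gridCell hn hxo hn1 hn2
      -- The corner of the cell containing `x`; the default `x` is taken for finitely many `n` only.
      set u : ℕ → ℝ × ℝ := fun n =>
        if h : ∃ q ∈ gridIndex (ε n) z, x ∈ gridCell (ε n) q then gridPoint (ε n) h.choose else x
      have hu : Tendsto u atTop (𝓝 x) := by
        refine tendsto_iff_dist_tendsto_zero.2 (squeeze_zero' (Eventually.of_forall fun _ =>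
          dist_nonneg) ?_ hε)
        filter_upwards [hex] with n hn
        simp only [u, dif_pos hn]
        rw [dist_comm]
        exact dist_gridPoint_le hn.choose_spec.2
      refine (hβ x u hu).congr' ?_
      filter_upwards [hex, hε_pos] with n hn hεn
      rw [hGeq n hεn _ hn.choose_spec.1 x hn.choose_spec.2]
      simp only [u, dif_pos hn]
    · rw [Set.indicator_of_notMem hxR]
      refine tendsto_const_nhds.congr' ?_
      filter_upwards [hε_pos] with n hn
      exact (hG0 n x fun q hq h => hxR (gridCell_subset hn hz hq h)).symm

end Riemann

/-! ### Local averages of the squared volatility -/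

section Volatility

variable {y : ℝ × ℝ → ℝ}

/-- The nearest-point projection onto `[-1,1]²`. -/
noncomputable def clamp (z : ℝ × ℝ) : ℝ × ℝ := (max (-1) (min z.1 1), max (-1) (min z.2 1))

theorem clamp_mem (z : ℝ × ℝ) : clamp z ∈ bigSquare :=
  ⟨⟨le_max_left _ _, le_max_left _ _⟩, max_le (by norm_num) (min_le_right _ _),
    max_le (by norm_num) (min_le_right _ _)⟩

theorem clamp_of_mem {z : ℝ × ℝ} (hz : z ∈ bigSquare) : clamp z = z := by
  obtain ⟨⟨h1, h2⟩, h3, h4⟩ := hz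
  simp only at h1 h2 h3 h4
  simp [clamp, h1, h2, h3, h4]

theorem dist_clamp_le (z z' : ℝ × ℝ) : dist (clamp z) (clamp z') ≤ dist z z' := by
  have key : ∀ a b : ℝ, dist (max (-1) (min a 1)) (max (-1) (min b 1)) ≤ dist a b := by
    intro a b
    simpa using ((LipschitzWith.id.min_const 1).const_max (-1)).dist_le_mul a b
  rw [Prod.dist_eq, Prod.dist_eq]
  exact max_le_max (key _ _) (key _ _)

theorem continuous_clamp : Continuous clamp := by unfold clamp; fun_prop

/-- The squared path `y²`, extended from `[-1,1]²` to the plane. -/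
noncomputable def sqVol (y : ℝ × ℝ → ℝ) (z : ℝ × ℝ) : ℝ := y (clamp z) ^ 2

theorem sqVol_of_mem {z : ℝ × ℝ} (hz : z ∈ bigSquare) : sqVol y z = y z ^ 2 := by
  rw [sqVol, clamp_of_mem hz]

theorem uniformContinuous_sqVol (hy : ContinuousOn y bigSquare) :
    UniformContinuous (sqVol y) := by
  have h := isCompact_bigSquare.uniformContinuousOn_of_continuous (hy.pow 2)
  rw [Metric.uniformContinuousOn_iff] at h
  rw [Metric.uniformContinuous_iff]
  intro r hr
  obtain ⟨δ, hδ, h'⟩ := h r hr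
  exact ⟨δ, hδ, fun a b hab => h' _ (clamp_mem a) _ (clamp_mem b)
    ((dist_clamp_le a b).trans_lt hab)⟩

/-- The lower bound keeps the variances used for standardization away from zero, relative to `c_n`.
-/
theorem exists_sqVol_bounds (hy : ContinuousOn y bigSquare) (hpos : ∀ z ∈ bigSquare, 0 < y z) :
    ∃ m M, 0 < m ∧ ∀ z, m ≤ sqVol y z ∧ sqVol y z ≤ M := by
  have hne : bigSquare.Nonempty := ⟨clamp 0, clamp_mem 0⟩
  obtain ⟨a, ha, ha'⟩ := isCompact_bigSquare.exists_isMinOn hne (hy.pow 2)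
  obtain ⟨b, hb, hb'⟩ := isCompact_bigSquare.exists_isMaxOn hne (hy.pow 2)
  exact ⟨y a ^ 2, y b ^ 2, pow_pos (hpos a ha) 2, fun z =>
    ⟨ha' (clamp_mem z), hb' (clamp_mem z)⟩⟩

/-- The average `∫ y²(z - ξ) ν(dξ)`. -/
noncomputable def avgVol (y : ℝ × ℝ → ℝ) (ν : Measure (ℝ × ℝ)) (z : ℝ × ℝ) : ℝ :=
  ∫ ξ, sqVol y (z - ξ) ∂ν

theorem sqVol_nonneg (y : ℝ × ℝ → ℝ) (z : ℝ × ℝ) : 0 ≤ sqVol y z := sq_nonneg _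

theorem avgVol_nonneg (y : ℝ × ℝ → ℝ) (ν : Measure (ℝ × ℝ)) (z : ℝ × ℝ) : 0 ≤ avgVol y ν z :=
  integral_nonneg fun _ => sqVol_nonneg _ _

theorem integrable_sqVol_sub (hy : ContinuousOn y bigSquare) (hpos : ∀ z ∈ bigSquare, 0 < y z)
    (ν : Measure (ℝ × ℝ)) [IsFiniteMeasure ν] (z : ℝ × ℝ) :
    Integrable (fun ξ => sqVol y (z - ξ)) ν := by
  obtain ⟨m, M, _, h⟩ := exists_sqVol_bounds hy hpos
  refine Integrable.of_bound (C := M) ?_ (ae_of_all _ fun ξ => ?_)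
  · exact ((uniformContinuous_sqVol hy).continuous.comp
      (continuous_const.sub continuous_id)).aestronglyMeasurable
  · rw [Real.norm_of_nonneg (sqVol_nonneg _ _)]
    exact (h _).2

theorem avgVol_bounds (hy : ContinuousOn y bigSquare) (hpos : ∀ z ∈ bigSquare, 0 < y z)
    {m M : ℝ} (h : ∀ z, m ≤ sqVol y z ∧ sqVol y z ≤ M) (ν : Measure (ℝ × ℝ))
    [IsProbabilityMeasure ν] (z : ℝ × ℝ) : m ≤ avgVol y ν z ∧ avgVol y ν z ≤ M := by
  have hi := integrable_sqVol_sub hy hpos ν z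
  rw [avgVol]
  constructor
  · simpa using integral_mono (integrable_const m) hi fun ξ => (h (z - ξ)).1
  · simpa using integral_mono hi (integrable_const M) fun ξ => (h (z - ξ)).2

/-- The bound does not involve `ν`, so the averages against all the `π_n` are equicontinuous. -/
theorem abs_avgVol_sub_le (hy : ContinuousOn y bigSquare) (hpos : ∀ z ∈ bigSquare, 0 < y z)
    {r : ℝ} {z z' : ℝ × ℝ} (h : ∀ ξ, dist (sqVol y (z - ξ)) (sqVol y (z' - ξ)) ≤ r)
    (ν : Measure (ℝ × ℝ)) [IsProbabilityMeasure ν] :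
    |avgVol y ν z - avgVol y ν z'| ≤ r := by
  rw [avgVol, avgVol, ← integral_sub (integrable_sqVol_sub hy hpos ν z)
    (integrable_sqVol_sub hy hpos ν z')]
  have := norm_integral_le_of_norm_le_const (μ := ν) (C := r)
    (f := fun ξ => sqVol y (z - ξ) - sqVol y (z' - ξ)) (ae_of_all _ fun ξ => by
      rw [← dist_eq_norm]; exact h ξ)
  simpa using this

/-- Weak convergence settles the fixed point `x`; equicontinuity absorbs the move from `x` to `u n`.
This is the continuous convergence that `tendsto_riemann_sum` needs. -/
theorem tendsto_avgVol (hy : ContinuousOn y bigSquare) (hpos : ∀ z ∈ bigSquare, 0 < y z)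
    {ν : ℕ → Measure (ℝ × ℝ)} {π : Measure (ℝ × ℝ)}
    (hν : ∀ᶠ n in atTop, IsProbabilityMeasure (ν n)) (hπ : ConvergesWeakly ν π) {x : ℝ × ℝ}
    {u : ℕ → ℝ × ℝ} (hu : Tendsto u atTop (𝓝 x)) :
    Tendsto (fun n => avgVol y (ν n) (u n)) atTop (𝓝 (avgVol y π x)) := by
  obtain ⟨m, M, _, hb⟩ := exists_sqVol_bounds hy hpos
  have hc := uniformContinuous_sqVol hy
  set f : (ℝ × ℝ) →ᵇ ℝ := BoundedContinuousFunction.ofNormedAddCommGroup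
    (fun ξ => sqVol y (x - ξ)) (hc.continuous.comp (continuous_const.sub continuous_id)) M (by
      intro ξ
      rw [Real.norm_of_nonneg (sqVol_nonneg _ _)]
      exact (hb _).2) with hf
  have h1 : Tendsto (fun n => avgVol y (ν n) x) atTop (𝓝 (avgVol y π x)) := hπ f
  have h2 : Tendsto (fun n => avgVol y (ν n) (u n) - avgVol y (ν n) x) atTop (𝓝 0) := by
    rw [Metric.tendsto_nhds]
    intro r hr
    obtain ⟨δ, hδ, h⟩ := Metric.uniformContinuous_iff.1 hc (r / 2) (by positivity)
    filter_upwards [hν, Metric.tendsto_nhds.1 hu δ hδ] with n hn hun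
    rw [dist_zero_right, Real.norm_eq_abs]
    refine (abs_avgVol_sub_le hy hpos (r := r / 2) (fun ξ => (h ?_).le) (ν n)).trans_lt
      (by linarith)
    rwa [dist_sub_right]
  simpa using h2.add h1

theorem continuous_avgVol (hy : ContinuousOn y bigSquare) (hpos : ∀ z ∈ bigSquare, 0 < y z)
    (π : Measure (ℝ × ℝ)) [IsProbabilityMeasure π] : Continuous (avgVol y π) := by
  refine continuous_iff_seqContinuous.2 fun u x hu => ?_
  exact tendsto_avgVol hy hpos (ν := fun _ => π) (Eventually.of_forall fun _ => inferInstance)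
    (fun f => tendsto_const_nhds) hu

theorem continuous_avgVol_rpow (hy : ContinuousOn y bigSquare)
    (hpos : ∀ z ∈ bigSquare, 0 < y z) (π : Measure (ℝ × ℝ)) [IsProbabilityMeasure π] {p : ℝ}
    (hp : 0 < p) : Continuous fun z => avgVol y π z ^ (p / 2) :=
  (continuous_avgVol hy hpos π).rpow_const fun _ => .inr (by positivity)

theorem sub_mem_bigSquare {z w : ℝ × ℝ} (hz : z ∈ unitSquare) (hw : w ∈ unitSquare) :
    z - w ∈ bigSquare := by
  simp only [unitSquare, bigSquare, Set.mem_Icc, Prod.le_def, Prod.fst_sub, Prod.snd_sub] at *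
  obtain ⟨⟨a1, a2⟩, a3, a4⟩ := hz
  obtain ⟨⟨b1, b2⟩, b3, b4⟩ := hw
  refine ⟨⟨?_, ?_⟩, ?_, ?_⟩ <;> linarith

/-- A difference of two points of `[0,1]²` lies in `[-1,1]²`, where clamping changes nothing. -/
theorem integral_sq_eq_avgVol {π : Measure (ℝ × ℝ)} (hπ : π unitSquareᶜ = 0) {u v : ℝ}
    (h : (u, v) ∈ unitSquare) : ∫ w, y (u - w.1, v - w.2) ^ 2 ∂π = avgVol y π (u, v) := by
  refine integral_congr_ae ?_
  have : ∀ᵐ w ∂π, w ∈ unitSquare := hπ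
  filter_upwards [this] with w hw
  exact (sqVol_of_mem (sub_mem_bigSquare h hw)).symm

theorem integratedVolatility_eq (hy : ContinuousOn y bigSquare)
    (hpos : ∀ z ∈ bigSquare, 0 < y z) {π : Measure (ℝ × ℝ)} [IsProbabilityMeasure π]
    (hπ : π unitSquareᶜ = 0) {p : ℝ} (hp : 0 < p) {z : ℝ × ℝ} (hz : z ∈ unitSquare) :
    integratedVolatility y p π z =
      ∫ x in Set.Ioc 0 z.1 ×ˢ Set.Ioc 0 z.2, avgVol y π x ^ (p / 2) := by
  obtain ⟨⟨h1, h2⟩, h3, h4⟩ := hz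
  simp only at h1 h2 h3 h4
  have hcont := continuous_avgVol_rpow hy hpos π hp
  rw [Measure.volume_eq_prod, setIntegral_prod, integratedVolatility,
    intervalIntegral.integral_of_le h1]
  · refine setIntegral_congr_fun measurableSet_Ioc fun u hu => ?_
    rw [intervalIntegral.integral_of_le h2]
    refine setIntegral_congr_fun measurableSet_Ioc fun v hv => ?_
    rw [integral_sq_eq_avgVol hπ]
    exact ⟨⟨hu.1.le, hv.1.le⟩, hu.2.trans h3, hv.2.trans h4⟩
  · refine (hcont.continuousOn.integrableOn_compact
      (isCompact_Icc (a := ((0 : ℝ), (0 : ℝ))) (b := z))).mono_set ?_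
    rintro ⟨u, v⟩ ⟨hu, hv⟩
    exact ⟨⟨hu.1.le, hv.1.le⟩, hu.2, hv.2⟩

/-- The variance of an increment in terms of the concentration measure. -/
theorem integral_sq_incrementKernel_mul {g : ℝ × ℝ → ℝ} (hg : IsWeightFunction g) {n : ℕ}
    (hn : 0 < scaling g n) {z : ℝ × ℝ} (h1 : (1 / (n : ℝ), 1 / (n : ℝ)) ≤ z) (h2 : z ≤ (1, 1)) :
    ∫ w in bigSquare, (incrementKernel g n (z - w) * y w) ^ 2 =
      scaling g n * avgVol y (concentrationMeasure g n) z := by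
  have e1 : ∫ w in bigSquare, (incrementKernel g n (z - w) * y w) ^ 2 =
      ∫ w, incrementKernel g n (z - w) ^ 2 * sqVol y w := by
    rw [← integral_indicator measurableSet_bigSquare]
    refine integral_congr_ae ?_
    have hae := (Measure.measurePreserving_sub_left (volume : Measure (ℝ × ℝ)) z
      ).quasiMeasurePreserving.ae (hg.ae_incrementKernel_eq_zero n)
    filter_upwards [hae] with w hw
    by_cases hwm : w ∈ bigSquare
    · rw [Set.indicator_of_mem hwm, sqVol_of_mem hwm, mul_pow]
    · rw [Set.indicator_of_notMem hwm, hw]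
      · simp
      -- If `z - w` is in `[0, 1 + 1/n]²` and `1/n ≤ z ≤ 1`, then `w` is in `[-1,1]²`; restricting
      -- the integral to that square loses nothing.
      · refine fun h => hwm ?_
        simp only [bigSquare, Set.mem_Icc, Prod.le_def, Prod.fst_sub, Prod.snd_sub] at *
        obtain ⟨⟨a1, a2⟩, a3, a4⟩ := h
        refine ⟨⟨?_, ?_⟩, ?_, ?_⟩ <;> linarith
  have e2 := integral_sub_left_eq_self
    (fun x => incrementKernel g n x ^ 2 * sqVol y (z - x)) volume z
  simp only [sub_sub_cancel] at e2
  rw [e1, e2, avgVol, integral_concentrationMeasure hg.memLp, mul_div_cancel₀ _ hn.ne']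
  simp_rw [mul_comm]

end Volatility

/-! ### Power variation as a sum over lattice points -/

theorem powerVariation_eq_sum (y : ℝ × ℝ → ℝ) (p : ℝ) (k n : ℕ) (z : ℝ × ℝ) :
    powerVariation y p k n z = ∑ q ∈ gridIndex ((k : ℝ) / n) z,
      |latticeIncrement y n (k * q.1) (k * q.2)| ^ p := by
  have h : ∀ x : ℝ, (n : ℝ) * x / k = x / ((k : ℝ) / n) := by
    intro x; rw [div_div_eq_mul_div, mul_comm]
  rw [powerVariation, gridIndex, Finset.sum_product, h, h]

/-- The lower bound `1/n` keeps all four corners of the increment in the unit square and the support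
of its kernel in `[-1,1]²`. -/
theorem gridPoint_mem {k n : ℕ} (hn : 1 ≤ n) (hk : 1 ≤ k) {z : ℝ × ℝ} (hz : z ∈ unitSquare)
    {q : ℕ × ℕ} (hq : q ∈ gridIndex ((k : ℝ) / n) z) :
    (1 / (n : ℝ), 1 / (n : ℝ)) ≤ gridPoint ((k : ℝ) / n) q ∧
      gridPoint ((k : ℝ) / n) q ≤ (1, 1) := by
  have hn' : (0 : ℝ) < n := by exact_mod_cast hn
  have hk' : (1 : ℝ) ≤ k := by exact_mod_cast hk
  have hε : 0 < (k : ℝ) / n := by positivity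
  obtain ⟨⟨h1, h2⟩, h3, h4⟩ := hz
  simp only at h1 h2 h3 h4
  simp only [gridIndex, Finset.mem_product, Finset.mem_Icc] at hq
  have key : ∀ {x : ℝ} {i : ℕ}, 0 ≤ x → x ≤ 1 → 1 ≤ i → i ≤ ⌊x / ((k : ℝ) / n)⌋₊ →
      1 / (n : ℝ) ≤ (k : ℝ) / n * i ∧ (k : ℝ) / n * i ≤ 1 := by
    intro x i hx hx1 hi hi'
    have hi1 : (1 : ℝ) ≤ i := by exact_mod_cast hi
    have h := (Nat.le_floor_iff (div_nonneg hx hε.le)).1 hi'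
    rw [le_div_iff₀ hε] at h
    constructor
    · rw [div_mul_eq_mul_div]
      gcongr
      nlinarith
    · linarith
  exact ⟨⟨(key h1 h3 hq.1.1 hq.1.2).1, (key h2 h4 hq.2.1 hq.2.2).1⟩,
    (key h1 h3 hq.1.1 hq.1.2).2, (key h2 h4 hq.2.1 hq.2.2).2⟩

/-! ### Convergence at a point for a fixed volatility path -/

section PathwiseLimit

variable {Ω : Type*} [MeasurableSpace Ω] {P : Measure Ω} {W : BorelSubset → Ω → ℝ}
  {g y : ℝ × ℝ → ℝ} {Y : ℝ × ℝ → Ω → ℝ}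

/-- The corners of lattice cells are rational. Asking `hY` at rational points only allows it to hold
for almost every volatility path simultaneously. -/
theorem isWienerIntegral_latticeIncrement (hW : IsWhiteNoise P W)
    (hY : ∀ a b : ℚ, ((a : ℝ), (b : ℝ)) ∈ unitSquare →
      IsWienerIntegral P W (fun w => g (((a : ℝ), (b : ℝ)) - w) * y w) (Y (a, b)))
    {k n : ℕ} (hn : 1 ≤ n) (hk : 1 ≤ k) {z : ℝ × ℝ} (hz : z ∈ unitSquare)
    {q : ℕ × ℕ} (hq : q ∈ gridIndex ((k : ℝ) / n) z) :
    IsWienerIntegral P W (fun w => incrementKernel g n (gridPoint ((k : ℝ) / n) q - w) * y w)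
      (fun ω => latticeIncrement (fun w => Y w ω) n (k * q.1) (k * q.2)) := by
  obtain ⟨⟨h1, h2⟩, h3, h4⟩ := gridPoint_mem hn hk hz hq
  simp only [gridPoint] at h1 h2 h3 h4
  have hn' : (0 : ℝ) < n := by exact_mod_cast hn
  have hn0 : 0 ≤ 1 / (n : ℝ) := by positivity
  have e : ∀ i : ℕ, (((k * i : ℕ) : ℝ)) / n = (k : ℝ) / n * i := by intro i; push_cast; ring
  have e' : ∀ i : ℕ, ((((k * i : ℕ) : ℝ)) - 1) / n = (k : ℝ) / n * i - 1 / n := by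
    intro i; rw [sub_div, e]
  have main : ∀ s t : ℝ, (∃ a : ℚ, (a : ℝ) = s) → (∃ b : ℚ, (b : ℝ) = t) → 0 ≤ s → s ≤ 1 →
      0 ≤ t → t ≤ 1 → IsWienerIntegral P W (fun w => g ((s, t) - w) * y w) (Y (s, t)) := by
    rintro s t ⟨a, rfl⟩ ⟨b, rfl⟩ a1 a2 b1 b2
    exact hY a b ⟨⟨a1, b1⟩, a2, b2⟩
  have hr1 : ∀ i : ℕ, ∃ a : ℚ, (a : ℝ) = (k : ℝ) / n * i := fun i =>
    ⟨(k : ℚ) / n * i, by push_cast; rfl⟩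
  have hr2 : ∀ i : ℕ, ∃ a : ℚ, (a : ℝ) = (k : ℝ) / n * i - 1 / n := fun i =>
    ⟨(k : ℚ) / n * i - 1 / n, by push_cast; rfl⟩
  have w22 := main _ _ (hr1 q.1) (hr1 q.2) (by linarith) h3 (by linarith) h4
  have w12 := main _ _ (hr2 q.1) (hr1 q.2) (by linarith) (by linarith) (by linarith) h4
  have w21 := main _ _ (hr1 q.1) (hr2 q.2) (by linarith) h3 (by linarith) (by linarith)
  have w11 := main _ _ (hr2 q.1) (hr2 q.2) (by linarith) (by linarith) (by linarith)
    (by linarith)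
  have h := (w22.linearComb hW w12 1 (-1)).linearComb hW (w21.linearComb hW w11 (-1) 1) 1 1
  convert h using 1
  · ext w
    have es : ∀ a b : ℝ, (a, b) - w = (a - w.1, b - w.2) := fun _ _ => rfl
    simp only [incrementKernel, gridPoint, es, sub_right_comm _ w.1, sub_right_comm _ w.2]
    ring
  · ext ω
    simp only [latticeIncrement, rectIncrement, e, e']
    ring

theorem integral_sq_sum_mul_sub [IsProbabilityMeasure P] {ι : Type*} (S : Finset ι) (β : ι → ℝ)
    {ξ : ι → Ω → ℝ} {m : ℝ} (hξ : ∀ i ∈ S, MemLp (ξ i) 2 P) (hm : ∀ i ∈ S, ∫ ω, ξ i ω ∂P = m) :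
    ∫ ω, (∑ i ∈ S, β i * (ξ i ω - m)) ^ 2 ∂P =
      ∑ i ∈ S, ∑ j ∈ S, β i * β j * (∫ ω, ξ i ω * ξ j ω ∂P - m ^ 2) := by
  have hmem : ∀ i ∈ S, MemLp (fun ω => ξ i ω - m) 2 P := fun i hi =>
    (hξ i hi).sub (memLp_const m)
  have hInt : ∀ i ∈ S, ∀ j ∈ S, Integrable (fun ω => (ξ i ω - m) * (ξ j ω - m)) P :=
    fun i hi j hj => (hmem i hi).integrable_mul (hmem j hj)
  have e : ∀ ω, (∑ i ∈ S, β i * (ξ i ω - m)) ^ 2 =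
      ∑ i ∈ S, ∑ j ∈ S, β i * β j * ((ξ i ω - m) * (ξ j ω - m)) := by
    intro ω
    rw [sq, Finset.sum_mul_sum]
    exact Finset.sum_congr rfl fun i _ => Finset.sum_congr rfl fun j _ => by ring
  simp_rw [e]
  rw [integral_finsetSum _ fun i hi => integrable_finsetSum _ fun j hj =>
    (hInt i hi j hj).const_mul _]
  refine Finset.sum_congr rfl fun i hi => ?_
  rw [integral_finsetSum _ fun j hj => (hInt i hi j hj).const_mul _]
  refine Finset.sum_congr rfl fun j hj => ?_
  rw [integral_const_mul]
  congr 1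
  have hij : Integrable (fun ω => ξ i ω * ξ j ω) P := (hξ i hi).integrable_mul (hξ j hj)
  have hi1 := (hξ i hi).integrable one_le_two
  have hj1 := (hξ j hj).integrable one_le_two
  have e2 : ∀ ω, (ξ i ω - m) * (ξ j ω - m) = ξ i ω * ξ j ω - m * ξ i ω - m * ξ j ω + m ^ 2 := by
    intro ω; ring
  simp_rw [e2]
  rw [integral_add (by exact (hij.sub (hi1.const_mul m)).sub (hj1.const_mul m))
      (integrable_const _),
    integral_sub (by exact hij.sub (hi1.const_mul m)) (hj1.const_mul m),
    integral_sub hij (hi1.const_mul m), integral_const_mul, integral_const_mul, hm i hi, hm j hj]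
  simp
  ring

theorem IsWienerIntegral.div_sqrt (hW : IsWhiteNoise P W) {f : ℝ × ℝ → ℝ} {X : Ω → ℝ}
    (h : IsWienerIntegral P W f X) (v : ℝ) :
    IsWienerIntegral P W (fun z => f z / √v) (fun ω => X ω / √v) := by
  have := h.linearComb hW h (1 / √v) 0
  convert this using 2 <;> ring

/-- The volatility enters the correlation only through the factor `M / m`, free of `n`; the rest is
the kernel overlap summed in `tendsto_correlation_sum`. -/
theorem abs_integral_div_sqrt_mul_le {H : ℝ × ℝ → ℝ} (hH : MemLp H 2 volume) {z z' : ℝ × ℝ}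
    {m M c v v' : ℝ} (hm : 0 < m) (hc : 0 < c) (hM : ∀ w, sqVol y w ≤ M)
    (hv : c * m ≤ v) (hv' : c * m ≤ v') :
    |∫ w in bigSquare, (H (z - w) * y w / √v) * (H (z' - w) * y w / √v')| ≤
      M / m * ((∫ w, |H (z - w)| * |H (z' - w)|) / c) := by
  have hM0 : 0 ≤ M := (sqVol_nonneg y 0).trans (hM 0)
  have hcm : 0 < c * m := by positivity
  have hvv : c * m ≤ √v * √v' := by
    calc c * m = √(c * m) * √(c * m) := (Real.mul_self_sqrt hcm.le).symm
      _ ≤ √v * √v' := by gcongr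
  have hI : Integrable (fun w => |H (z - w)| * |H (z' - w)|) :=
    (memLp_comp_sub_left hH z).abs.integrable_mul (memLp_comp_sub_left hH z').abs
  have hb : ∀ w ∈ bigSquare, ‖(H (z - w) * y w / √v) * (H (z' - w) * y w / √v')‖ ≤
      M / (c * m) * (|H (z - w)| * |H (z' - w)|) := by
    intro w hw
    have e : (H (z - w) * y w / √v) * (H (z' - w) * y w / √v') =
        (H (z - w) * H (z' - w)) * sqVol y w / (√v * √v') := by
      rw [sqVol_of_mem hw]; ring
    rw [e, Real.norm_eq_abs, abs_div, abs_mul, abs_mul, abs_of_nonneg (sqVol_nonneg _ _),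
      abs_of_nonneg (by positivity : 0 ≤ √v * √v')]
    calc _ ≤ |H (z - w)| * |H (z' - w)| * M / (c * m) := by
          gcongr
          exact hM w
      _ = _ := by ring
  calc _ ≤ ∫ w in bigSquare, M / (c * m) * (|H (z - w)| * |H (z' - w)|) := by
        exact norm_integral_le_of_norm_le (hI.const_mul (M / (c * m))).integrableOn
          ((ae_restrict_iff' measurableSet_bigSquare).2 (ae_of_all _ hb))
    _ ≤ ∫ w, M / (c * m) * (|H (z - w)| * |H (z' - w)|) :=
        setIntegral_le_integral (hI.const_mul _) (ae_of_all _ fun w => by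
          have : 0 ≤ M / (c * m) := by positivity
          exact mul_nonneg this (by positivity))
    _ = _ := by rw [integral_const_mul]; field_simp

/-- The power variation, normalized as in the law of large numbers. -/
noncomputable def normalizedVariation (g : ℝ × ℝ → ℝ) (p : ℝ) (k n : ℕ) (y : ℝ × ℝ → ℝ)
    (z : ℝ × ℝ) : ℝ :=
  ((k : ℝ) / n) ^ 2 / scaling g n ^ (p / 2) * powerVariation y p k n z

/-- Standardizing an increment of variance `c_n b` takes out the factor `(c_n b)^{p/2}`, whose `c_n`
part cancels the normalization. -/
theorem normalizedVariation_eq_sum {p : ℝ} {k n : ℕ} (hc : 0 < scaling g n) {b : ℕ × ℕ → ℝ}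
    (hb : ∀ q, 0 < b q) (x : ℝ × ℝ → ℝ) (z : ℝ × ℝ) :
    normalizedVariation g p k n x z = ∑ q ∈ gridIndex ((k : ℝ) / n) z,
      ((k : ℝ) / n) ^ 2 * b q ^ (p / 2) *
        |latticeIncrement x n (k * q.1) (k * q.2) / √(scaling g n * b q)| ^ p := by
  rw [normalizedVariation, powerVariation_eq_sum, Finset.mul_sum]
  refine Finset.sum_congr rfl fun q _ => ?_
  have hbq := hb q
  have h1 : √(scaling g n * b q) ^ p = scaling g n ^ (p / 2) * b q ^ (p / 2) := by
    rw [Real.sqrt_eq_rpow, ← Real.rpow_mul (by positivity),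
      ← Real.mul_rpow hc.le hbq.le]
    congr 1; ring
  have h2 : 0 < scaling g n ^ (p / 2) := Real.rpow_pos_of_pos hc _
  have h3 : 0 < b q ^ (p / 2) := Real.rpow_pos_of_pos hbq _
  rw [abs_div, abs_of_nonneg (Real.sqrt_nonneg _), Real.div_rpow (abs_nonneg _)
    (Real.sqrt_nonneg _), h1]
  field_simp

/-- The centring is the mean for the fixed path, so the integral is a variance. It expands into
covariances with positive weights, to which `hcov` applies. -/
theorem integral_sq_normalizedVariation_sub_le {p η C m M : ℝ} (hp : 0 < p) (hη : 0 ≤ η)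
    (hC : 0 ≤ C) (hW : IsWhiteNoise P W)
    (hcov : ∀ {f f' : ℝ × ℝ → ℝ} {X X' : Ω → ℝ}, IsWienerIntegral P W f X →
      IsWienerIntegral P W f' X' → ∫ z in bigSquare, f z ^ 2 = 1 →
      ∫ z in bigSquare, f' z ^ 2 = 1 →
      |∫ ω, |X ω| ^ p * |X' ω| ^ p ∂P - gaussianAbsMoment p ^ 2| ≤
        η + C * |∫ z in bigSquare, f z * f' z|)
    (hg : IsWeightFunction g) (hy : ContinuousOn y bigSquare)
    (hpos : ∀ z ∈ bigSquare, 0 < y z) (hm : 0 < m) (hb : ∀ z, m ≤ sqVol y z ∧ sqVol y z ≤ M)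
    (hY : ∀ a b : ℚ, ((a : ℝ), (b : ℝ)) ∈ unitSquare →
      IsWienerIntegral P W (fun w => g (((a : ℝ), (b : ℝ)) - w) * y w) (Y (a, b)))
    {k n : ℕ} (hn : 1 ≤ n) (hk : 1 ≤ k) (hc : 0 < scaling g n) {z : ℝ × ℝ}
    (hz : z ∈ unitSquare) :
    Integrable (fun ω => (normalizedVariation g p k n (fun w => Y w ω) z -
      gaussianAbsMoment p * (((k : ℝ) / n) ^ 2 * ∑ q ∈ gridIndex ((k : ℝ) / n) z,
        avgVol y (concentrationMeasure g n) (gridPoint ((k : ℝ) / n) q) ^ (p / 2))) ^ 2) P ∧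
    ∫ ω, (normalizedVariation g p k n (fun w => Y w ω) z -
      gaussianAbsMoment p * (((k : ℝ) / n) ^ 2 * ∑ q ∈ gridIndex ((k : ℝ) / n) z,
        avgVol y (concentrationMeasure g n) (gridPoint ((k : ℝ) / n) q) ^ (p / 2))) ^ 2 ∂P ≤
      (M ^ (p / 2)) ^ 2 * (η + C * (M / m) * (((k : ℝ) / n) ^ 4 *
        ∑ q ∈ gridIndex ((k : ℝ) / n) z, ∑ q' ∈ gridIndex ((k : ℝ) / n) z,
          (∫ w, |incrementKernel g n (gridPoint ((k : ℝ) / n) q - w)| *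
            |incrementKernel g n (gridPoint ((k : ℝ) / n) q' - w)|) / scaling g n)) := by
  have := hW.gaussian.isProbabilityMeasure
  have := isProbabilityMeasure_concentrationMeasure hg.memLp hc
  set ε := (k : ℝ) / n with hε_def
  have hε : 0 < ε := by
    have : (0 : ℝ) < n := by exact_mod_cast hn
    have : (0 : ℝ) < k := by exact_mod_cast hk
    positivity
  set c := scaling g n
  set S := gridIndex ε z
  set b : ℕ × ℕ → ℝ := fun q => avgVol y (concentrationMeasure g n) (gridPoint ε q) with hb_def
  have hbb : ∀ q, m ≤ b q ∧ b q ≤ M := fun q => avgVol_bounds hy hpos hb _ _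
  have hb0 : ∀ q, 0 < b q := fun q => hm.trans_le (hbb q).1
  set Z : ℕ × ℕ → Ω → ℝ := fun q ω =>
    latticeIncrement (fun w => Y w ω) n (k * q.1) (k * q.2) / √(c * b q) with hZ_def
  have hZ : ∀ q ∈ S, IsWienerIntegral P W
      (fun w => incrementKernel g n (gridPoint ε q - w) * y w / √(c * b q)) (Z q) :=
    fun q hq => (isWienerIntegral_latticeIncrement hW hY hn hk hz hq).div_sqrt hW _
  have hZ1 : ∀ q ∈ S, ∫ w in bigSquare,
      (incrementKernel g n (gridPoint ε q - w) * y w / √(c * b q)) ^ 2 = 1 := by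
    intro q hq
    obtain ⟨h1, h2⟩ := gridPoint_mem hn hk hz hq
    have hcb : 0 < c * b q := mul_pos hc (hb0 q)
    simp_rw [div_pow, Real.sq_sqrt hcb.le]
    rw [integral_div, integral_sq_incrementKernel_mul hg hc h1 h2]
    exact div_self hcb.ne'
  have hsum : ∀ ω, normalizedVariation g p k n (fun w => Y w ω) z -
      gaussianAbsMoment p * (ε ^ 2 * ∑ q ∈ S, b q ^ (p / 2)) =
      ∑ q ∈ S, ε ^ 2 * b q ^ (p / 2) * (|Z q ω| ^ p - gaussianAbsMoment p) := by
    intro ω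
    rw [normalizedVariation_eq_sum hc hb0]
    simp only [mul_sub, Finset.sum_sub_distrib, Finset.mul_sum]
    congr 1
    exact Finset.sum_congr rfl fun q _ => by ring
  have hmem : ∀ q ∈ S, MemLp (fun ω => |Z q ω| ^ p) 2 P := fun q hq =>
    (hZ q hq).memLp_abs_rpow hW hp
  have hmean : ∀ q ∈ S, ∫ ω, |Z q ω| ^ p ∂P = gaussianAbsMoment p := fun q hq =>
    (hZ q hq).integral_abs_rpow hW (hZ1 q hq)
  have hterm : ∀ q ∈ S, ∀ q' ∈ S,
      (ε ^ 2 * b q ^ (p / 2)) * (ε ^ 2 * b q' ^ (p / 2)) *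
        (∫ ω, |Z q ω| ^ p * |Z q' ω| ^ p ∂P - gaussianAbsMoment p ^ 2) ≤
      (M ^ (p / 2)) ^ 2 * (ε ^ 4 * η + C * (M / m) * (ε ^ 4 *
        ((∫ w, |incrementKernel g n (gridPoint ε q - w)| *
            |incrementKernel g n (gridPoint ε q' - w)|) / c))) := by
    intro q hq q' hq'
    have h1 := (le_abs_self _).trans (hcov (hZ q hq) (hZ q' hq') (hZ1 q hq) (hZ1 q' hq'))
    have h2 := abs_integral_div_sqrt_mul_le (y := y) (memLp_incrementKernel hg.memLp n)
      (z := gridPoint ε q) (z' := gridPoint ε q') hm hc (fun w => (hb w).2)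
      (mul_le_mul_of_nonneg_left (hbb q).1 hc.le) (mul_le_mul_of_nonneg_left (hbb q').1 hc.le)
    have h3 : b q ^ (p / 2) ≤ M ^ (p / 2) :=
      Real.rpow_le_rpow (hb0 q).le (hbb q).2 (by positivity)
    have h4 : b q' ^ (p / 2) ≤ M ^ (p / 2) :=
      Real.rpow_le_rpow (hb0 q').le (hbb q').2 (by positivity)
    have h5 : 0 < b q ^ (p / 2) := Real.rpow_pos_of_pos (hb0 q) _
    have h6 : 0 < b q' ^ (p / 2) := Real.rpow_pos_of_pos (hb0 q') _
    have h7 := h1.trans (add_le_add_right (mul_le_mul_of_nonneg_left h2 hC) η)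
    have h8 : 0 ≤ η + C * (M / m * ((∫ w, |incrementKernel g n (gridPoint ε q - w)| *
            |incrementKernel g n (gridPoint ε q' - w)|) / c)) :=
      add_nonneg hη (mul_nonneg hC ((abs_nonneg _).trans h2))
    have h9 : 0 ≤ ε ^ 2 * M ^ (p / 2) := mul_nonneg (sq_nonneg ε) (h5.le.trans h3)
    calc _ ≤ (ε ^ 2 * b q ^ (p / 2)) * (ε ^ 2 * b q' ^ (p / 2)) * _ :=
          mul_le_mul_of_nonneg_left h7 (by positivity)
      _ ≤ (ε ^ 2 * M ^ (p / 2)) * (ε ^ 2 * M ^ (p / 2)) * _ := by gcongr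
      _ = _ := by ring
  constructor
  · have h : MemLp (fun ω => ∑ q ∈ S,
        ε ^ 2 * b q ^ (p / 2) * (|Z q ω| ^ p - gaussianAbsMoment p)) 2 P :=
      memLp_finsetSum _ fun q hq => ((hmem q hq).sub (memLp_const _)).const_mul _
    exact h.integrable_sq.congr (ae_of_all _ fun ω => congrArg (· ^ 2) (hsum ω).symm)
  · refine (integral_congr_ae (ae_of_all _ fun ω => congrArg (· ^ 2) (hsum ω))).trans_le ?_
    rw [integral_sq_sum_mul_sub S _ hmem hmean]
    refine (Finset.sum_le_sum fun q hq => Finset.sum_le_sum fun q' hq' =>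
      hterm q hq q' hq').trans ?_
    simp only [← Finset.mul_sum, Finset.sum_add_distrib, Finset.sum_const, nsmul_eq_mul]
    -- The pairs have total weight at most one, so `η` is not multiplied.
    have h1 : ε ^ 4 * ((S.card : ℝ) * ((S.card : ℝ) * η)) ≤ η := by
      have h2 := sq_mul_card_gridIndex_le hε hz
      calc ε ^ 4 * ((S.card : ℝ) * ((S.card : ℝ) * η)) = (ε ^ 2 * S.card) ^ 2 * η := by ring
        _ ≤ 1 * η := by
          gcongr
          exact pow_le_one₀ (by positivity) h2
        _ = η := one_mul η
    gcongr

/-- Conditionally on the volatility, the normalized power variation converges in probability. -/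
theorem tendsto_measure_normalizedVariation {p : ℝ} (hp : 0 < p) (hW : IsWhiteNoise P W)
    (hg : IsWeightFunction g) (hy : ContinuousOn y bigSquare)
    (hpos : ∀ z ∈ bigSquare, 0 < y z)
    (hY : ∀ a b : ℚ, ((a : ℝ), (b : ℝ)) ∈ unitSquare →
      IsWienerIntegral P W (fun w => g (((a : ℝ), (b : ℝ)) - w) * y w) (Y (a, b)))
    {k : ℕ → ℕ} (hk_pos : ∀ n, 1 ≤ n → 1 ≤ k n)
    (hk : Tendsto (fun n => (k n : ℝ) / n) atTop (𝓝 0))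
    {π : Measure (ℝ × ℝ)} [IsProbabilityMeasure π] (hπ_null : volume π.support = 0)
    (hπ : ConvergesWeakly (concentrationMeasure g) π) {z : ℝ × ℝ} (hz : z ∈ unitSquare)
    {r : ℝ} (hr : 0 < r) :
    Tendsto (fun n => P {ω | r ≤ |normalizedVariation g p (k n) n (fun w => Y w ω) z -
      gaussianAbsMoment p * integratedVolatility y p π z|}) atTop (𝓝 0) := by
  have := hW.gaussian.isProbabilityMeasure
  obtain ⟨m, M, hm, hb⟩ := exists_sqVol_bounds hy hpos
  set ε : ℕ → ℝ := fun n => (k n : ℝ) / n with hε_def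
  have hε_pos : ∀ᶠ n in atTop, 0 < ε n := by
    filter_upwards [eventually_ge_atTop 1] with n hn
    have h1 : (0 : ℝ) < n := by exact_mod_cast hn
    have h2 : (0 : ℝ) < k n := by exact_mod_cast hk_pos n hn
    exact div_pos h2 h1
  have hc := eventually_scaling_pos hg.memLp hπ
  have hprob : ∀ᶠ n in atTop, IsProbabilityMeasure (concentrationMeasure g n) := by
    filter_upwards [hc] with n hn
    exact isProbabilityMeasure_concentrationMeasure hg.memLp hn
  have hcorr := tendsto_correlation_sum hg hπ_null hπ hε_pos hk hz
  set corr : ℕ → ℝ := fun n => ε n ^ 4 * ∑ q ∈ gridIndex (ε n) z, ∑ q' ∈ gridIndex (ε n) z,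
      (∫ w, |incrementKernel g n (gridPoint (ε n) q - w)| *
        |incrementKernel g n (gridPoint (ε n) q' - w)|) / scaling g n
  set R : ℕ → ℝ := fun n => gaussianAbsMoment p * (ε n ^ 2 * ∑ q ∈ gridIndex (ε n) z,
    avgVol y (concentrationMeasure g n) (gridPoint (ε n) q) ^ (p / 2))
  have hR : Tendsto R atTop (𝓝 (gaussianAbsMoment p * integratedVolatility y p π z)) := by
    rw [integratedVolatility_eq hy hpos (measure_compl_unitSquare_eq_zero hg hπ) hp hz]
    refine Tendsto.const_mul _ (tendsto_riemann_sum (C := M ^ (p / 2))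
      (β := fun n x => avgVol y (concentrationMeasure g n) x ^ (p / 2))
      (b := fun x => avgVol y π x ^ (p / 2)) (fun x u hu => ?_) ?_ hε_pos hk hz)
    · exact (tendsto_avgVol hy hpos hprob hπ hu).rpow_const (.inr (by positivity))
    · filter_upwards [hprob] with n hn x
      have hbx := avgVol_bounds hy hpos hb (concentrationMeasure g n) x
      rw [abs_of_nonneg (Real.rpow_nonneg (avgVol_nonneg _ _ _) _)]
      exact Real.rpow_le_rpow (avgVol_nonneg _ _ _) hbx.2 (by positivity)
  rw [ENNReal.tendsto_nhds_zero]
  intro a ha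
  -- `a` may be infinite; the minimum with one makes it real.
  obtain ⟨a', ha', haa'⟩ : ∃ a' : ℝ, 0 < a' ∧ ENNReal.ofReal a' ≤ a := by
    refine ⟨(min a 1).toReal, ENNReal.toReal_pos (by simp [ha.ne']) (by simp), ?_⟩
    rw [ENNReal.ofReal_toReal (by simp)]
    exact min_le_left _ _
  set B := (M ^ (p / 2)) ^ 2
  have hM : 0 < M := hm.trans_le ((hb 0).1.trans (hb 0).2)
  have hB : 0 < B := by have := Real.rpow_pos_of_pos hM (p / 2); positivity
  -- Chosen so that the variance bound `B (η + η)` is exactly what Chebyshev's inequality at level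
  -- `r / 2` needs. The other `r / 2` covers the deterministic error of `R n`.
  set η := a' * (r / 2) ^ 2 / (2 * B) with hη_def
  have hη : 0 < η := by positivity
  obtain ⟨C, hC, hcov⟩ := exists_abs_covariance_abs_rpow_le hp hη
  have hsmall : ∀ᶠ n in atTop, C * (M / m) * corr n < η := by
    have : Tendsto (fun n => C * (M / m) * corr n) atTop (𝓝 (C * (M / m) * 0)) :=
      hcorr.const_mul _
    rw [mul_zero] at this
    exact this.eventually_lt_const hη
  have hRn : ∀ᶠ n in atTop,
      |R n - gaussianAbsMoment p * integratedVolatility y p π z| < r / 2 := by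
    have := Metric.tendsto_nhds.1 hR (r / 2) (by positivity)
    simpa only [Real.dist_eq] using this
  filter_upwards [hc, hsmall, hRn, eventually_ge_atTop 1] with n hcn hsn hRn hn
  obtain ⟨hInt, hle⟩ := integral_sq_normalizedVariation_sub_le hp hη.le hC hW
    (fun h1 h2 h3 h4 => hcov hW h1 h2 h3 h4) hg hy hpos hm hb hY hn (hk_pos n hn) hcn hz
  refine le_trans ?_ haa'
  have hsub : {ω | r ≤ |normalizedVariation g p (k n) n (fun w => Y w ω) z -
      gaussianAbsMoment p * integratedVolatility y p π z|} ⊆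
      {ω | (r / 2) ^ 2 ≤ (normalizedVariation g p (k n) n (fun w => Y w ω) z - R n) ^ 2} := by
    intro ω hω
    simp only [Set.mem_ofPred_eq] at hω ⊢
    rw [← sq_abs (_ - R n)]
    refine pow_le_pow_left₀ (by positivity) ?_ 2
    have := abs_sub_le (normalizedVariation g p (k n) n (fun w => Y w ω) z) (R n)
      (gaussianAbsMoment p * integratedVolatility y p π z)
    linarith
  refine (measure_mono hsub).trans ?_
  have hmk := mul_meas_ge_le_integral_of_nonneg (ae_of_all _ fun ω => sq_nonneg _) hInt
    ((r / 2) ^ 2)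
  rw [ENNReal.le_ofReal_iff_toReal_le (measure_ne_top _ _) ha'.le]
  have hfin : (r / 2) ^ 2 * P.real
      {ω | (r / 2) ^ 2 ≤ (normalizedVariation g p (k n) n (fun w => Y w ω) z - R n) ^ 2} ≤
      (r / 2) ^ 2 * a' := by
    refine (hmk.trans hle).trans ?_
    calc B * (η + C * (M / m) * corr n) ≤ B * (η + η) := by gcongr
      _ = (r / 2) ^ 2 * a' := by rw [hη_def]; field_simp; ring
  exact le_of_mul_le_mul_left hfin (by positivity)

end PathwiseLimit

/-! ### Regularity of the paths -/

section Cadlag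

theorem eventually_floor_div_eq_right {ε : ℝ} (hε : 0 < ε) {s : ℝ} (hs : 0 ≤ s) :
    ∀ᶠ u in 𝓝[>] s, ⌊u / ε⌋₊ = ⌊s / ε⌋₊ := by
  have h1 : s < ε * (⌊s / ε⌋₊ + 1) := by
    have := Nat.lt_floor_add_one (s / ε)
    rw [div_lt_iff₀ hε] at this
    linarith
  filter_upwards [Ioo_mem_nhdsGT h1] with u hu
  have hu0 : 0 ≤ u := hs.trans hu.1.le
  rw [Nat.floor_eq_iff (by positivity)]
  have h2 := Nat.floor_le (div_nonneg hs hε.le)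
  constructor
  · exact h2.trans (by gcongr; exact hu.1.le)
  · rw [div_lt_iff₀ hε]; linarith [hu.2]

theorem exists_eventually_floor_div_eq_left {ε : ℝ} (hε : 0 < ε) (s : ℝ) :
    ∃ N : ℕ, ∀ᶠ u in 𝓝[<] s, ⌊u / ε⌋₊ = N := by
  rcases le_or_gt s 0 with hs | hs
  · refine ⟨0, ?_⟩
    filter_upwards [self_mem_nhdsWithin] with u hu
    exact Nat.floor_of_nonpos
      (div_nonpos_of_nonpos_of_nonneg ((Set.mem_Iio.1 hu).le.trans hs) hε.le)
  · have hpos : 0 < s / ε := div_pos hs hε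
    -- The left limit of the floor is the ceiling minus one, which differs from the floor exactly
    -- when `s` is a multiple of `ε`.
    obtain ⟨N, hN⟩ : ∃ N, ⌈s / ε⌉₊ = N + 1 :=
      Nat.exists_eq_succ_of_ne_zero (Nat.ceil_pos.2 hpos).ne'
    have h1 := Nat.ceil_lt_add_one hpos.le
    have h2 := Nat.le_ceil (s / ε)
    rw [hN] at h1 h2
    push_cast at h1 h2
    have h3 : ε * N < s := by
      have : (N : ℝ) < s / ε := by linarith
      rw [lt_div_iff₀ hε] at this
      linarith
    refine ⟨N, ?_⟩
    filter_upwards [Ioo_mem_nhdsLT h3] with u hu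
    have hu0 : 0 ≤ u := le_trans (by positivity) hu.1.le
    rw [Nat.floor_eq_iff (by positivity)]
    constructor
    · rw [le_div_iff₀ hε]; linarith [hu.1]
    · have : u / ε < s / ε := by gcongr; exact hu.2
      linarith

theorem isCadlag_floor {ε : ℝ} (hε : 0 < ε) (F : ℕ → ℕ → ℝ) :
    IsCadlag fun z => F ⌊z.1 / ε⌋₊ ⌊z.2 / ε⌋₊ := by
  intro s hs t ht
  obtain ⟨N, hN⟩ := exists_eventually_floor_div_eq_left hε s
  obtain ⟨N', hN'⟩ := exists_eventually_floor_div_eq_left hε t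
  have rs := (eventually_floor_div_eq_right hε hs.1).filter_mono
    (nhdsWithin_mono s (fun _ h => h.1 : Set.Ioc s 1 ⊆ Set.Ioi s))
  have rt := (eventually_floor_div_eq_right hε ht.1).filter_mono
    (nhdsWithin_mono t (fun _ h => h.1 : Set.Ioc t 1 ⊆ Set.Ioi t))
  have ls := hN.filter_mono (nhdsWithin_mono s (fun _ h => h.2 : Set.Ico 0 s ⊆ Set.Iio s))
  have lt := hN'.filter_mono (nhdsWithin_mono t (fun _ h => h.2 : Set.Ico 0 t ⊆ Set.Iio t))
  have key : ∀ {A B : Set ℝ} {a b : ℕ}, (∀ᶠ u in 𝓝[A] s, ⌊u / ε⌋₊ = a) →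
      (∀ᶠ v in 𝓝[B] t, ⌊v / ε⌋₊ = b) →
      Tendsto (fun z : ℝ × ℝ => F ⌊z.1 / ε⌋₊ ⌊z.2 / ε⌋₊) (𝓝[A ×ˢ B] (s, t)) (𝓝 (F a b)) := by
    intro A B a b hA hB
    rw [nhdsWithin_prod_eq]
    refine tendsto_const_nhds.congr' ?_
    filter_upwards [hA.prod_mk hB] with z hz
    rw [hz.1, hz.2]
  exact ⟨key rs rt, ⟨_, key ls rt⟩, ⟨_, key ls lt⟩, ⟨_, key rs lt⟩⟩

theorem isCadlag_of_continuousOn {f : ℝ × ℝ → ℝ} (hf : ContinuousOn f unitSquare) :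
    IsCadlag f := by
  intro s hs t ht
  have h : ∀ {A B : Set ℝ}, A ⊆ Set.Icc 0 1 → B ⊆ Set.Icc 0 1 →
      Tendsto f (𝓝[A ×ˢ B] (s, t)) (𝓝 (f (s, t))) := by
    intro A B hA hB
    refine (hf (s, t) ⟨⟨hs.1, ht.1⟩, hs.2, ht.2⟩).mono_left (nhdsWithin_mono _ ?_)
    rintro z ⟨h1, h2⟩
    exact ⟨⟨(hA h1).1, (hB h2).1⟩, (hA h1).2, (hB h2).2⟩
  have r : ∀ {s : ℝ}, s ∈ Set.Icc (0 : ℝ) 1 → Set.Ioc s 1 ⊆ Set.Icc 0 1 := fun hs u hu =>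
    ⟨hs.1.trans hu.1.le, hu.2⟩
  have l : ∀ {s : ℝ}, s ∈ Set.Icc (0 : ℝ) 1 → Set.Ico 0 s ⊆ Set.Icc 0 1 := fun hs u hu =>
    ⟨hu.1, hu.2.le.trans hs.2⟩
  exact ⟨h (r hs) (r ht), ⟨_, h (l hs) (r ht)⟩, ⟨_, h (l hs) (l ht)⟩, ⟨_, h (r hs) (l ht)⟩⟩

theorem isCadlag_normalizedVariation (g : ℝ × ℝ → ℝ) (p : ℝ) {k n : ℕ} (hn : 1 ≤ n) (hk : 1 ≤ k)
    (y : ℝ × ℝ → ℝ) : IsCadlag (normalizedVariation g p k n y) := by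
  have hn' : (0 : ℝ) < n := by exact_mod_cast hn
  have hk' : (0 : ℝ) < k := by exact_mod_cast hk
  have h := isCadlag_floor (div_pos hk' hn') fun a b =>
    ((k : ℝ) / n) ^ 2 / scaling g n ^ (p / 2) * ∑ q ∈ Finset.Icc 1 a ×ˢ Finset.Icc 1 b,
      |latticeIncrement y n (k * q.1) (k * q.2)| ^ p
  convert h using 2 with z
  rw [normalizedVariation, powerVariation_eq_sum, gridIndex]

theorem continuousOn_integratedVolatility {y : ℝ × ℝ → ℝ} (hy : ContinuousOn y bigSquare)
    (hpos : ∀ z ∈ bigSquare, 0 < y z) {π : Measure (ℝ × ℝ)} [IsProbabilityMeasure π]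
    (hπ : π unitSquareᶜ = 0) {p : ℝ} (hp : 0 < p) :
    ContinuousOn (integratedVolatility y p π) unitSquare := by
  have hcont := continuous_avgVol_rpow hy hpos π hp
  have h1 : Continuous fun q : ℝ × ℝ =>
      ∫ v in (0 : ℝ)..q.2, avgVol y π (q.1, v) ^ (p / 2) := by
    refine intervalIntegral.continuous_parametric_intervalIntegral_of_continuous
      (f := fun (q : ℝ × ℝ) v => avgVol y π (q.1, v) ^ (p / 2)) ?_ continuous_snd
    exact hcont.comp (by fun_prop : Continuous fun r : (ℝ × ℝ) × ℝ => (r.1.1, r.2))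
  have h2 : Continuous fun z : ℝ × ℝ =>
      ∫ u in (0 : ℝ)..z.1, ∫ v in (0 : ℝ)..z.2, avgVol y π (u, v) ^ (p / 2) := by
    refine intervalIntegral.continuous_parametric_intervalIntegral_of_continuous
      (f := fun (z : ℝ × ℝ) u => ∫ v in (0 : ℝ)..z.2, avgVol y π (u, v) ^ (p / 2)) ?_
      continuous_fst
    exact h1.comp (by fun_prop : Continuous fun r : (ℝ × ℝ) × ℝ => (r.2, r.1.2))
  refine h2.continuousOn.congr fun z hz => ?_
  obtain ⟨⟨z1, z2⟩, z3, z4⟩ := hz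
  simp only at z1 z2 z3 z4
  refine intervalIntegral.integral_congr fun u hu => ?_
  refine intervalIntegral.integral_congr fun v hv => ?_
  rw [Set.uIcc_of_le z1] at hu
  rw [Set.uIcc_of_le z2] at hv
  rw [integral_sq_eq_avgVol hπ]
  exact ⟨⟨hu.1, hv.1⟩, hu.2.trans z3, hv.2.trans z4⟩

end Cadlag

/-! ### Monotonicity and uniform closeness from a finite grid -/

section Monotone

theorem monotoneOn_integratedVolatility {y : ℝ × ℝ → ℝ} (hy : ContinuousOn y bigSquare)
    (hpos : ∀ z ∈ bigSquare, 0 < y z) {π : Measure (ℝ × ℝ)} [IsProbabilityMeasure π]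
    (hπ : π unitSquareᶜ = 0) {p : ℝ} (hp : 0 < p) :
    MonotoneOn (integratedVolatility y p π) unitSquare := by
  intro z hz z' hz' hzz'
  rw [integratedVolatility_eq hy hpos hπ hp hz, integratedVolatility_eq hy hpos hπ hp hz']
  refine setIntegral_mono_set ?_ (ae_of_all _ fun x => Real.rpow_nonneg (avgVol_nonneg _ _ _) _)
    (Set.prod_mono (Set.Ioc_subset_Ioc_right hzz'.1)
      (Set.Ioc_subset_Ioc_right hzz'.2)).eventuallyLE
  refine ((continuous_avgVol_rpow hy hpos π hp).continuousOn.integrableOn_compact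
      (isCompact_Icc (a := ((0 : ℝ), (0 : ℝ))) (b := z'))).mono_set ?_
  rintro ⟨u, v⟩ ⟨hu, hv⟩
  exact ⟨⟨hu.1.le, hv.1.le⟩, hu.2, hv.2⟩

theorem monotone_normalizedVariation (g : ℝ × ℝ → ℝ) (p : ℝ) (k n : ℕ) (y : ℝ × ℝ → ℝ) :
    Monotone (normalizedVariation g p k n y) := by
  intro z z' hzz'
  simp only [normalizedVariation, powerVariation_eq_sum]
  have hε : 0 ≤ (k : ℝ) / n := by positivity
  have : 0 ≤ scaling g n ^ (p / 2) := Real.rpow_nonneg (scaling_nonneg g n) _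
  refine mul_le_mul_of_nonneg_left (Finset.sum_le_sum_of_subset_of_nonneg ?_ fun q _ _ => ?_)
    (by positivity)
  · refine Finset.product_subset_product ?_ ?_ <;> refine Finset.Icc_subset_Icc_right ?_
    · exact Nat.floor_mono (div_le_div_of_nonneg_right hzz'.1 hε)
    · exact Nat.floor_mono (div_le_div_of_nonneg_right hzz'.2 hε)
  · positivity

theorem gridPoint_mem_unitSquare {N : ℕ} (hN : 0 < N) {q : ℕ × ℕ} (h1 : q.1 ≤ N) (h2 : q.2 ≤ N) :
    gridPoint (1 / (N : ℝ)) q ∈ unitSquare := by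
  have key : ∀ {i : ℕ}, i ≤ N → 0 ≤ 1 / (N : ℝ) * i ∧ 1 / (N : ℝ) * i ≤ 1 := by
    intro i hi
    have : (0 : ℝ) < N := by exact_mod_cast hN
    refine ⟨by positivity, ?_⟩
    rw [one_div, inv_mul_le_iff₀ this]
    simpa using hi
  exact ⟨⟨(key h1).1, (key h2).1⟩, (key h1).2, (key h2).2⟩

theorem exists_gridPoint_le_le {N : ℕ} (hN : 0 < N) {z : ℝ × ℝ} (hz : z ∈ unitSquare) :
    ∃ q : ℕ × ℕ, q.1 < N ∧ q.2 < N ∧ gridPoint (1 / (N : ℝ)) q ≤ z ∧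
      z ≤ gridPoint (1 / (N : ℝ)) (q.1 + 1, q.2 + 1) := by
  have hN' : (0 : ℝ) < N := by exact_mod_cast hN
  have key : ∀ {x : ℝ}, 0 ≤ x → x ≤ 1 → ∃ i : ℕ, i < N ∧ 1 / (N : ℝ) * i ≤ x ∧
      x ≤ 1 / (N : ℝ) * (i + 1 : ℕ) := by
    intro x hx hx1
    simp only [one_div, inv_mul_le_iff₀ hN', le_inv_mul_iff₀ hN']
    rcases hx1.lt_or_eq with h | rfl
    · refine ⟨⌊N * x⌋₊, ?_, Nat.floor_le (by positivity), ?_⟩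
      · rw [Nat.floor_lt (by positivity)]
        nlinarith
      · push_cast
        exact (Nat.lt_floor_add_one _).le
    -- At `x = 1` the floor would be `N`, outside the range, so the last cell is used.
    · refine ⟨N - 1, by omega, ?_, ?_⟩
      · rw [mul_one]; exact_mod_cast Nat.sub_le N 1
      · rw [Nat.sub_add_cancel hN, mul_one]
  obtain ⟨⟨h1, h2⟩, h3, h4⟩ := hz
  obtain ⟨i, hi, hi1, hi2⟩ := key h1 h3
  obtain ⟨j, hj, hj1, hj2⟩ := key h2 h4
  exact ⟨(i, j), hi, hj, ⟨hi1, hj1⟩, hi2, hj2⟩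

/-- Monotone functions that are close on a fine grid are uniformly close. -/
theorem uniformDist_lt_of_grid {f F : ℝ × ℝ → ℝ} (hf : MonotoneOn f unitSquare)
    (hF : MonotoneOn F unitSquare) {r : ℝ} (hr : 0 < r) {N : ℕ} (hN : 0 < N)
    (h1 : ∀ q : ℕ × ℕ, q ∈ Finset.range (N + 1) ×ˢ Finset.range (N + 1) →
      |f (gridPoint (1 / (N : ℝ)) q) - F (gridPoint (1 / (N : ℝ)) q)| < r / 4)
    (h2 : ∀ q : ℕ × ℕ, q ∈ Finset.range N ×ˢ Finset.range N →
      F (gridPoint (1 / (N : ℝ)) (q.1 + 1, q.2 + 1)) - F (gridPoint (1 / (N : ℝ)) q) < r / 4) :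
    uniformDist f F < ENNReal.ofReal r := by
  -- Sandwiching `z` between grid corners costs `r / 4` for the distance at a corner and `r / 4` for
  -- the increment of `F`. A supremum loses strictness, hence `r / 2` in between.
  refine lt_of_le_of_lt (b := ENNReal.ofReal (r / 2)) (iSup₂_le fun z hz => ?_)
    ((ENNReal.ofReal_lt_ofReal_iff hr).2 (by linarith))
  rw [edist_dist, Real.dist_eq]
  refine ENNReal.ofReal_le_ofReal ?_
  obtain ⟨q, hq1, hq2, hl, hu⟩ := exists_gridPoint_le_le hN hz
  have ml := gridPoint_mem_unitSquare hN hq1.le hq2.le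
  have mu := gridPoint_mem_unitSquare (q := (q.1 + 1, q.2 + 1)) hN hq1 hq2
  have a1 := h1 q (by simp; omega)
  have a2 := h1 (q.1 + 1, q.2 + 1) (by simp; omega)
  have a3 := h2 q (by simp; omega)
  have b1 := hf ml hz hl
  have b2 := hf hz mu hu
  have b3 := hF ml hz hl
  have b4 := hF hz mu hu
  rw [abs_lt] at a1 a2
  rw [abs_le]
  constructor <;> linarith [a1.1, a1.2, a2.1, a2.2]

end Monotone

/-! ### Measurability and removal of the conditioning -/

section Measurability

variable {Ω' : Type*} [MeasurableSpace Ω'] {σ : Ω' → ℝ × ℝ → ℝ}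

/-- The clamped field is measurable in `ω` and continuous in the point, hence jointly measurable;
integration in a parameter preserves this. -/
theorem measurable_integratedVolatility (hσ : IsVolatilityField σ) {π : Measure (ℝ × ℝ)}
    [IsProbabilityMeasure π] (hπ : π unitSquareᶜ = 0) {p : ℝ} (hp : 0 < p) {z : ℝ × ℝ}
    (hz : z ∈ unitSquare) : Measurable fun ω => integratedVolatility (σ ω) p π z := by
  simp_rw [fun ω => integratedVolatility_eq (hσ.continuousOn ω) (hσ.pos ω) hπ hp hz]
  have h1 : Measurable (Function.uncurry fun (z : ℝ × ℝ) (ω : Ω') => σ ω (clamp z)) := by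
    refine measurable_uncurry_of_continuous_of_measurable (fun ω => ?_) fun z =>
      hσ.measurable _ (clamp_mem z)
    exact (hσ.continuousOn ω).comp_continuous continuous_clamp clamp_mem
  have h2 : Measurable fun r : (Ω' × (ℝ × ℝ)) × (ℝ × ℝ) => sqVol (σ r.1.1) (r.1.2 - r.2) :=
    (h1.comp (by fun_prop : Measurable fun r : (Ω' × (ℝ × ℝ)) × (ℝ × ℝ) =>
      (r.1.2 - r.2, r.1.1))).pow_const 2
  have h3 : Measurable fun r : Ω' × (ℝ × ℝ) => avgVol (σ r.1) π r.2 ^ (p / 2) :=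
    (h2.stronglyMeasurable.integral_prod_right (ν := π)).measurable.pow_const _
  exact (h3.stronglyMeasurable.integral_prod_right
    (ν := volume.restrict (Set.Ioc 0 z.1 ×ˢ Set.Ioc 0 z.2))).measurable

variable {Ω : Type*} [MeasurableSpace Ω] {P : Measure Ω} {P' : Measure Ω'}

theorem aemeasurable_normalizedVariation {W : BorelSubset → Ω → ℝ} {g : ℝ × ℝ → ℝ}
    {Y : ℝ × ℝ → Ω × Ω' → ℝ} (hY : IsAmbitField P P' W σ g Y) (p : ℝ) {k n : ℕ}
    (hk : 1 ≤ n → 1 ≤ k) {z : ℝ × ℝ} (hz : z ∈ unitSquare) :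
    AEMeasurable (fun ω => normalizedVariation g p k n (fun w => Y w ω) z) (P.prod P') := by
  simp only [normalizedVariation, powerVariation_eq_sum]
  refine AEMeasurable.const_mul (Finset.aemeasurable_fun_sum _ fun q hq => ?_) _
  -- For `n = 0` division by zero makes the index set empty.
  rcases Nat.eq_zero_or_pos n with rfl | hn
  · simp [gridIndex] at hq
  obtain ⟨⟨h1, h2⟩, h3, h4⟩ := gridPoint_mem hn (hk hn) hz hq
  simp only [gridPoint] at h1 h2 h3 h4
  have hn' : (0 : ℝ) < n := by exact_mod_cast hn
  have hn0 : 0 ≤ 1 / (n : ℝ) := by positivity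
  have e : ∀ i : ℕ, (((k * i : ℕ) : ℝ)) / n = (k : ℝ) / n * i := by intro i; push_cast; ring
  have e' : ∀ i : ℕ, ((((k * i : ℕ) : ℝ)) - 1) / n = (k : ℝ) / n * i - 1 / n := by
    intro i; rw [sub_div, e]
  have w22 := hY.aemeasurable ((k : ℝ) / n * q.1, (k : ℝ) / n * q.2)
    ⟨⟨by simp only; linarith, by simp only; linarith⟩, h3, h4⟩
  have w12 := hY.aemeasurable ((k : ℝ) / n * q.1 - 1 / n, (k : ℝ) / n * q.2)
    ⟨⟨by simp only; linarith, by simp only; linarith⟩, by simp only; linarith, h4⟩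
  have w21 := hY.aemeasurable ((k : ℝ) / n * q.1, (k : ℝ) / n * q.2 - 1 / n)
    ⟨⟨by simp only; linarith, by simp only; linarith⟩, h3, by simp only; linarith⟩
  have w11 := hY.aemeasurable ((k : ℝ) / n * q.1 - 1 / n, (k : ℝ) / n * q.2 - 1 / n)
    ⟨⟨by simp only; linarith, by simp only; linarith⟩, by simp only; linarith,
      by simp only; linarith⟩
  simp only [latticeIncrement, rectIncrement, e, e']
  exact (((w22.sub w12).sub w21).add w11).abs.pow_const p

variable [IsProbabilityMeasure P'] [IsProbabilityMeasure P]

/-- Conditional convergence in probability implies convergence in probability. -/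
theorem tendsto_prod_measure_of_ae_tendsto {d : ℕ → Ω × Ω' → ℝ}
    (hd : ∀ n, AEMeasurable (d n) (P.prod P')) {r : ℝ}
    (h : ∀ᵐ ω' ∂P', Tendsto (fun n => P {ω | r ≤ d n (ω, ω')}) atTop (𝓝 0)) :
    Tendsto (fun n => (P.prod P') {ω | r ≤ d n ω}) atTop (𝓝 0) := by
  -- Fubini needs measurable sets. The measurable version agrees with `d n` on almost every section.
  set e : ℕ → Ω × Ω' → ℝ := fun n => (hd n).mk (d n)
  have hS : ∀ n, MeasurableSet {ω | r ≤ e n ω} := fun n =>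
    measurableSet_le measurable_const (hd n).measurable_mk
  have h1 : ∀ n, (P.prod P') {ω | r ≤ d n ω} =
      ∫⁻ ω', P {ω | r ≤ e n (ω, ω')} ∂P' := by
    intro n
    have : {ω | r ≤ d n ω} =ᵐ[P.prod P'] {ω | r ≤ e n ω} := by
      filter_upwards [(hd n).ae_eq_mk] with ω hω
      exact propext (by change r ≤ d n ω ↔ r ≤ e n ω; rw [hω])
    rw [measure_congr this, Measure.prod_apply_symm (hS n)]
    rfl
  have h2 : ∀ n, ∀ᵐ ω' ∂P', P {ω | r ≤ e n (ω, ω')} = P {ω | r ≤ d n (ω, ω')} := by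
    intro n
    have hsw : ∀ᵐ q ∂(P'.prod P), d n q.swap = e n q.swap :=
      Measure.measurePreserving_swap.quasiMeasurePreserving.ae (hd n).ae_eq_mk
    filter_upwards [Measure.ae_ae_of_ae_prod hsw] with ω' hω'
    refine measure_congr ?_
    filter_upwards [hω'] with ω hω
    exact propext (by
      change r ≤ e n (ω, ω') ↔ r ≤ d n (ω, ω')
      rw [show d n (ω, ω') = e n (ω, ω') from hω])
  simp_rw [h1]
  rw [← lintegral_zero (μ := P')]
  refine tendsto_lintegral_of_dominated_convergence (fun _ => 1)
    (fun n => measurable_measure_prodMk_right (hS n)) (fun n => ae_of_all _ fun _ => prob_le_one)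
    (by simp) ?_
  filter_upwards [h, ae_all_iff.2 h2] with ω' hω' h2'
  simpa only [h2'] using hω'

/-- Each path of the limit is uniformly continuous, so each `ω` leaves these events once the grid is
fine enough; for a finite measure this suffices. The mesh `1 / (N + 1)` avoids division by zero. -/
theorem tendsto_measure_grid_increment (hσ : IsVolatilityField σ) {π : Measure (ℝ × ℝ)}
    [IsProbabilityMeasure π] (hπ : π unitSquareᶜ = 0) {p : ℝ} (hp : 0 < p) (c : ℝ) {r : ℝ}
    (hr : 0 < r) :
    Tendsto (fun N : ℕ => (P.prod P') {ω | ∃ q : ℕ × ℕ, q ∈ Finset.range (N + 1) ×ˢ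
      Finset.range (N + 1) ∧ r ≤
        c * integratedVolatility (σ ω.2) p π (gridPoint (1 / (N + 1 : ℕ)) (q.1 + 1, q.2 + 1)) -
        c * integratedVolatility (σ ω.2) p π (gridPoint (1 / (N + 1 : ℕ)) q)}) atTop (𝓝 0) := by
  rw [← measure_empty (μ := P.prod P')]
  refine tendsto_measure_of_tendsto_indicator_of_isFiniteMeasure atTop _ (fun N => ?_) fun ω => ?_
  · have : {ω : Ω × Ω' | ∃ q : ℕ × ℕ, q ∈ Finset.range (N + 1) ×ˢ Finset.range (N + 1) ∧ r ≤
        c * integratedVolatility (σ ω.2) p π (gridPoint (1 / (N + 1 : ℕ)) (q.1 + 1, q.2 + 1)) -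
        c * integratedVolatility (σ ω.2) p π (gridPoint (1 / (N + 1 : ℕ)) q)} =
        ⋃ q ∈ Finset.range (N + 1) ×ˢ Finset.range (N + 1), {ω | r ≤
        c * integratedVolatility (σ ω.2) p π (gridPoint (1 / (N + 1 : ℕ)) (q.1 + 1, q.2 + 1)) -
        c * integratedVolatility (σ ω.2) p π (gridPoint (1 / (N + 1 : ℕ)) q)} := by
      ext ω; simp
    rw [this]
    refine Finset.measurableSet_biUnion _ fun q hq => ?_
    simp only [Finset.mem_product, Finset.mem_range] at hq
    have m1 := (measurable_integratedVolatility hσ hπ hp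
      (gridPoint_mem_unitSquare (q := (q.1 + 1, q.2 + 1)) N.succ_pos hq.1 hq.2)).comp
      (measurable_snd : Measurable (Prod.snd : Ω × Ω' → Ω'))
    have m2 := (measurable_integratedVolatility hσ hπ hp
      (gridPoint_mem_unitSquare (q := q) N.succ_pos hq.1.le hq.2.le)).comp
      (measurable_snd : Measurable (Prod.snd : Ω × Ω' → Ω'))
    exact measurableSet_le measurable_const ((m1.const_mul c).sub (m2.const_mul c))
  · have hc := (continuousOn_integratedVolatility (hσ.continuousOn ω.2) (hσ.pos ω.2) hπ hp)
    have hu := isCompact_unitSquare.uniformContinuousOn_of_continuous (hc.const_smul c)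
    obtain ⟨δ, hδ, h⟩ := Metric.uniformContinuousOn_iff.1 hu r hr
    have hlim : Tendsto (fun N : ℕ => 1 / ((N : ℝ) + 1)) atTop (𝓝 0) :=
      tendsto_one_div_add_atTop_nhds_zero_nat
    filter_upwards [hlim.eventually_lt_const hδ] with N hN
    simp only [Set.mem_empty_iff_false, iff_false]
    rintro ⟨q, hq, hrq⟩
    simp only [Finset.mem_product, Finset.mem_range] at hq
    have := h _ (gridPoint_mem_unitSquare (q := (q.1 + 1, q.2 + 1)) N.succ_pos hq.1 hq.2) _
      (gridPoint_mem_unitSquare (q := q) N.succ_pos hq.1.le hq.2.le) ?_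
    · rw [Real.dist_eq] at this
      exact absurd (hrq.trans (le_abs_self _)) (not_le.2 this)
    · refine lt_of_le_of_lt ?_ hN
      have hN0 : (0 : ℝ) ≤ 1 / ((N : ℝ) + 1) := by positivity
      simp only [gridPoint, Prod.dist_eq, Real.dist_eq]
      push_cast
      rw [← mul_sub, ← mul_sub]
      simp [abs_of_nonneg (by positivity : (0 : ℝ) ≤ (N : ℝ) + 1)]

end Measurability

/-! ### The law of large numbers -/

section LawOfLargeNumbers

variable {ΩW Ωσ : Type*} [MeasurableSpace ΩW] [MeasurableSpace Ωσ]
  {PW : Measure ΩW} [IsProbabilityMeasure PW] {Pσ : Measure Ωσ} [IsProbabilityMeasure Pσ]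
  {W : BorelSubset → ΩW → ℝ} {σ : Ωσ → ℝ × ℝ → ℝ} {g : ℝ × ℝ → ℝ}
  {Y : ℝ × ℝ → ΩW × Ωσ → ℝ} {p : ℝ} {k : ℕ → ℕ}
  {π : Measure (ℝ × ℝ)} [IsProbabilityMeasure π]

/-- Convergence in probability of the normalized power variation at a fixed point. -/
theorem tendsto_prod_measure_normalizedVariation (hW : IsWhiteNoise PW W)
    (hσ : IsVolatilityField σ) (hg : IsWeightFunction g) (hY : IsAmbitField PW Pσ W σ g Y)
    (hp : 0 < p) (hk_pos : ∀ n, 1 ≤ n → 1 ≤ k n)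
    (hk : Tendsto (fun n => (k n : ℝ) / n) atTop (𝓝 0)) (hπ_null : volume π.support = 0)
    (hπ : ConvergesWeakly (concentrationMeasure g) π) {z : ℝ × ℝ} (hz : z ∈ unitSquare)
    {r : ℝ} (hr : 0 < r) :
    Tendsto (fun n => (PW.prod Pσ) {ω | r ≤ |normalizedVariation g p (k n) n (fun w => Y w ω) z -
      gaussianAbsMoment p * integratedVolatility (σ ω.2) p π z|}) atTop (𝓝 0) := by
  have hsq := measure_compl_unitSquare_eq_zero hg hπ
  refine tendsto_prod_measure_of_ae_tendsto (d := fun n ω =>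
    |normalizedVariation g p (k n) n (fun w => Y w ω) z -
      gaussianAbsMoment p * integratedVolatility (σ ω.2) p π z|) (fun n => ?_) ?_
  · have h1 := aemeasurable_normalizedVariation hY p (hk_pos n) hz
    have h2 := ((measurable_integratedVolatility hσ hsq hp hz).comp
      (measurable_snd : Measurable (Prod.snd : ΩW × Ωσ → Ωσ))).const_mul (gaussianAbsMoment p)
    exact (h1.sub h2.aemeasurable).abs
  -- The exceptional null set depends on the point; countably many of them may be united.
  · have hae : ∀ᵐ ω' ∂Pσ, ∀ a b : ℚ, ((a : ℝ), (b : ℝ)) ∈ unitSquare →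
        IsWienerIntegral PW W (fun w => g (((a : ℝ), (b : ℝ)) - w) * σ ω' w)
          (fun ω => Y ((a : ℝ), (b : ℝ)) (ω, ω')) := by
      refine ae_all_iff.2 fun a => ae_all_iff.2 fun b => ?_
      by_cases hab : ((a : ℝ), (b : ℝ)) ∈ unitSquare
      · filter_upwards [hY.isWienerIntegral _ hab] with ω' h _ using h
      · exact ae_of_all _ fun _ h => absurd h hab
    filter_upwards [hae] with ω' hω'
    exact tendsto_measure_normalizedVariation (Y := fun z ω => Y z (ω, ω')) hp hW hg
      (hσ.continuousOn ω') (hσ.pos ω') hω' hk_pos hk hπ_null hπ hz hr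

/-- The event is covered by a large grid increment of the limit or a large error at one of finitely
many grid points. Only monotonicity and subadditivity of the measure are used, so the event itself
need not be measurable. -/
theorem tendsto_prod_measure_uniformDist (hW : IsWhiteNoise PW W)
    (hσ : IsVolatilityField σ) (hg : IsWeightFunction g) (hY : IsAmbitField PW Pσ W σ g Y)
    (hp : 0 < p) (hk_pos : ∀ n, 1 ≤ n → 1 ≤ k n)
    (hk : Tendsto (fun n => (k n : ℝ) / n) atTop (𝓝 0)) (hπ_null : volume π.support = 0)
    (hπ : ConvergesWeakly (concentrationMeasure g) π) {r : ℝ} (hr : 0 < r) :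
    Tendsto (fun n => (PW.prod Pσ) {ω | ENNReal.ofReal r ≤
      uniformDist (normalizedVariation g p (k n) n fun w => Y w ω)
        fun z => gaussianAbsMoment p * integratedVolatility (σ ω.2) p π z}) atTop (𝓝 0) := by
  have hsq := measure_compl_unitSquare_eq_zero hg hπ
  have hr4 : 0 < r / 4 := by positivity
  rw [ENNReal.tendsto_nhds_zero]
  intro a ha
  have ha2 : 0 < a / 2 := ENNReal.half_pos ha.ne'
  -- The grid is fixed before `n`, since its fineness concerns the limit alone.
  obtain ⟨N, hN⟩ := (ENNReal.tendsto_nhds_zero.1 (tendsto_measure_grid_increment (P := PW)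
    (P' := Pσ) hσ hsq hp (gaussianAbsMoment p) hr4) (a / 2) ha2).exists
  set A := {ω : ΩW × Ωσ | ∃ q : ℕ × ℕ, q ∈ Finset.range (N + 1) ×ˢ Finset.range (N + 1) ∧
    r / 4 ≤ gaussianAbsMoment p *
        integratedVolatility (σ ω.2) p π (gridPoint (1 / (N + 1 : ℕ)) (q.1 + 1, q.2 + 1)) -
      gaussianAbsMoment p *
        integratedVolatility (σ ω.2) p π (gridPoint (1 / (N + 1 : ℕ)) q)}
  set T := Finset.range (N + 1 + 1) ×ˢ Finset.range (N + 1 + 1)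
  set D : ℕ → ℕ × ℕ → Set (ΩW × Ωσ) := fun n q => {ω | r / 4 ≤
    |normalizedVariation g p (k n) n (fun w => Y w ω) (gridPoint (1 / (N + 1 : ℕ)) q) -
      gaussianAbsMoment p * integratedVolatility (σ ω.2) p π (gridPoint (1 / (N + 1 : ℕ)) q)|}
  have hsub : ∀ n, {ω | ENNReal.ofReal r ≤
      uniformDist (normalizedVariation g p (k n) n fun w => Y w ω)
        fun z => gaussianAbsMoment p * integratedVolatility (σ ω.2) p π z} ⊆
      A ∪ ⋃ q ∈ T, D n q := by
    intro n ω hω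
    by_contra hcon
    rw [Set.mem_union, not_or] at hcon
    obtain ⟨hA, hD⟩ := hcon
    rw [Set.mem_ofPred_eq] at hω
    refine hω.not_gt (uniformDist_lt_of_grid (N := N + 1)
      ((monotone_normalizedVariation _ _ _ _ _).monotoneOn _)
      ?_ hr N.succ_pos (fun q hq => ?_) fun q hq => ?_)
    · intro z hz z' hz' hzz'
      exact mul_le_mul_of_nonneg_left (monotoneOn_integratedVolatility (hσ.continuousOn _)
        (hσ.pos _) hsq hp hz hz' hzz') (gaussianAbsMoment_nonneg p)
    · by_contra h
      exact hD (Set.mem_biUnion hq (not_lt.1 h))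
    · by_contra h
      exact hA ⟨q, hq, not_lt.1 h⟩
  have hDlim : Tendsto (fun n => ∑ q ∈ T, (PW.prod Pσ) (D n q)) atTop (𝓝 0) := by
    rw [← Finset.sum_const_zero (ι := ℕ × ℕ) (s := T)]
    refine tendsto_finsetSum _ fun q hq => ?_
    simp only [T, Finset.mem_product, Finset.mem_range] at hq
    exact tendsto_prod_measure_normalizedVariation hW hσ hg hY hp hk_pos hk hπ_null hπ
      (gridPoint_mem_unitSquare N.succ_pos (Nat.lt_succ_iff.1 hq.1) (Nat.lt_succ_iff.1 hq.2)) hr4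
  filter_upwards [ENNReal.tendsto_nhds_zero.1 hDlim (a / 2) ha2] with n hn
  calc _ ≤ (PW.prod Pσ) (A ∪ ⋃ q ∈ T, D n q) := measure_mono (hsub n)
    _ ≤ (PW.prod Pσ) A + ∑ q ∈ T, (PW.prod Pσ) (D n q) :=
        (measure_union_le _ _).trans (by gcongr; exact measure_biUnion_finset_le _ _)
    _ ≤ a / 2 + a / 2 := by gcongr
    _ = a := ENNReal.add_halves a

end LawOfLargeNumbers

end Ambit

theorem theorem1
    {ΩW Ωσ : Type*} [MeasurableSpace ΩW] [MeasurableSpace Ωσ]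
    (PW : Measure ΩW) [IsProbabilityMeasure PW]
    (Pσ : Measure Ωσ) [IsProbabilityMeasure Pσ]
    (W : Ambit.BorelSubset → ΩW → ℝ) (hW : Ambit.IsWhiteNoise PW W)
    (σ : Ωσ → ℝ × ℝ → ℝ) (hσ : Ambit.IsVolatilityField σ)
    (g : ℝ × ℝ → ℝ) (hg : Ambit.IsWeightFunction g)
    (Y : ℝ × ℝ → ΩW × Ωσ → ℝ) (hY : Ambit.IsAmbitField PW Pσ W σ g Y)
    (p : ℝ) (hp : 0 < p)
    (k : ℕ → ℕ) (hk_pos : ∀ n, 1 ≤ n → 1 ≤ k n) (hk_mono : MonotoneOn k (Set.Ici 1))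
    (hk : Tendsto (fun n => (k n : ℝ) / n) atTop (𝓝 0))
    (π : Measure (ℝ × ℝ)) [IsProbabilityMeasure π]
    (hπ_null : volume π.support = 0)
    (hπ : Ambit.ConvergesWeakly (Ambit.concentrationMeasure g) π) :
    Ambit.TendstoInProbabilityCadlag (PW.prod Pσ)
      (fun n ω z => ((k n : ℝ) / n) ^ 2 / Ambit.scaling g n ^ (p / 2) *
        Ambit.powerVariation (fun w => Y w ω) p (k n) n z)
      (fun ω z => Ambit.gaussianAbsMoment p *
        Ambit.integratedVolatility (σ ω.2) p π z) := by
  have hsq := Ambit.measure_compl_unitSquare_eq_zero hg hπ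
  refine ⟨fun n hn ω => Ambit.isCadlag_normalizedVariation g p hn (hk_pos n hn) _, fun ω => ?_,
    fun r hr => Ambit.tendsto_prod_measure_uniformDist hW hσ hg hY hp hk_pos hk hπ_null hπ hr⟩
  exact Ambit.isCadlag_of_continuousOn ((Ambit.continuousOn_integratedVolatility
    (hσ.continuousOn ω.2) (hσ.pos ω.2) hsq hp).const_smul (Ambit.gaussianAbsMoment p))
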